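/- Let $n\ge 1$, let $\lambda=(\lambda_1>\lambda_2>\cdots>\lambda_n>0)$ be a strict partition of length $n$, put $m=\lambda_1$, $\delta=(n,n-1,\ldots,1)$ and $\mu=\lambda-\delta$, which is a partition of length at most $n$. Let $\mathbf x=(x_1,\ldots,x_n)$, $\mathbf y=(y_1,\ldots,y_n)$ and $\mathbf a=(a_1,a_2,\ldots)$ be elements of a commutative ring (for example, independent parameters). Let $\mathcal A^\lambda$ be the set of all $n\times m$ matrices $A=(A_{ij})$ with entries in $\{1,0,-1\}$ such that: the non-zero entries alternate in sign across each row and down each column; the rightmost non-zero entry in each row is $1$; the topmost non-zero entry in each column that has one is $1$; $\sum_{j=1}^m A_{ij}=1$ for every $i$; and $\sum_{i=1}^n A_{ij}$ is $1$ if $j=\lambda_k$ for some $k$, and $0$ otherwise. The compass point matrix $C(A)=(c_{ij})$ of $A\in\mathcal A^\lambda$ has $c_{ij}=\mathrm{WE}$ if $A_{ij}=1$ and $c_{ij}=\mathrm{NS}$ if $A_{ij}=-1$. If $A_{ij}=0$, let $\nu$ be the nearest non-zero entry above position $(i,j)$ in its column and $\varepsilon$ the nearest non-zero entry to the right of $(i,j)$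 in its row, each taken to be $-1$ if there is none; then $c_{ij}=\mathrm{NE},\mathrm{SE},\mathrm{NW},\mathrm{SW}$ according as $(\nu,\varepsilon)=(1,-1),(-1,-1),(1,1),(-1,1)$. Put $$\mathrm{wgt}(A)=\prod_{i=1}^n x_i\ \prod_{i=1}^n\prod_{j=1}^m \mathrm{wgt}(c_{ij}),$$ where an entry $c_{ij}$ at position $(i,j)$ has weight $1$ if it is $\mathrm{WE}$, $\mathrm{NE}$ or $\mathrm{SE}$, weight $x_i+y_i$ if it is $\mathrm{NS}$, weight $y_i-a_j$ if it is $\mathrm{NW}$, and weight $x_i+a_j$ if it is $\mathrm{SW}$. Then $$\sum_{A\in\mathcal A^\lambda}\mathrm{wgt}(A)=\prod_{i=1}^n x_i\ \prod_{1\le i<j\le n}(x_i+y_j)\ s_\mu(\mathbf x|\mathbf a),$$ where $s_\mu(\mathbf x|\mathbf a)=\sum_T\prod_{(i,j)}\bigl(x_{T_{ij}}+a_{T_{ij}+j-i}\bigr)$ is the factorial Schur function; here $T$ runs over the semistandard tableaux of shape $\mu$ with entries in $\{1,\ldots,n\}$ (rows weakly increasing, columns strictly increasing), and $(i,j)$ over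 the boxes of the diagram of $\mu$ (row $i$, column $j$). -/

import Mathlib

/-- A strict partition of length exactly `n`: strictly decreasing positive parts.
With `i : Fin n` counted from `0`, `lam.parts i` is the part usually written `λ_{i+1}`. -/
structure StrictPartition (n : ℕ) where
  parts : Fin n → ℕ
  strictAnti : StrictAnti parts
  pos : ∀ i, 0 < parts i

namespace StrictPartition

variable {n : ℕ}

theorem add_sub_le (lam : StrictPartition n) :
    ∀ (d : ℕ) (i k : Fin n), (i : ℕ) + d = k → lam.parts k + d ≤ lam.parts i
  | 0, i, k, h => by
      have : i = k := Fin.ext (by simpa using h)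
      simp [this]
  | d + 1, i, k, h => by
      have hk := k.isLt
      have h1 := add_sub_le lam d ⟨i + 1, by omega⟩ k (by simp only; omega)
      have h2 : lam.parts ⟨i + 1, by omega⟩ < lam.parts i :=
        lam.strictAnti (Fin.lt_def.mpr (by simp))
      omega

/-- No truncation occurs in `λ_i - δ_i`, where `δ = (n, n-1, …, 1)`. -/
theorem delta_le (lam : StrictPartition n) (i : Fin n) : n - (i : ℕ) ≤ lam.parts i := by
  have hi := i.isLt
  have h := lam.add_sub_le (n - 1 - i) i ⟨n - 1, by omega⟩ (by simp only; omega)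
  have h0 := lam.pos ⟨n - 1, by omega⟩
  omega

/-- The Young diagram of `μ = λ - δ`, where `δ = (n, n-1, …, 1)`
(rows and columns are counted from `0`, so that `δ` has entry `n - i` in row `i`). -/
def subDelta (lam : StrictPartition n) : YoungDiagram where
  cells := (Finset.univ : Finset (Fin n)).biUnion fun i =>
    (Finset.range (lam.parts i - (n - (i : ℕ)))).image fun j => ((i : ℕ), j)
  isLowerSet := by
    rintro ⟨i, j⟩ ⟨i', j'⟩ hle h
    obtain ⟨h1, h2⟩ := Prod.mk_le_mk.mp hle
    simp only [Finset.coe_biUnion, Finset.coe_image, Set.mem_iUnion, Set.mem_image,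
      Finset.mem_coe, Finset.mem_range, Finset.mem_univ, exists_prop, true_and,
      Prod.mk.injEq] at h ⊢
    obtain ⟨k, b, hb, rfl, rfl⟩ := h
    have hk := k.isLt
    have h3 := lam.add_sub_le (k - i') ⟨i', by omega⟩ k (by simp only; omega)
    exact ⟨⟨i', by omega⟩, j', by simp only; omega, rfl, rfl⟩

theorem mem_subDelta (lam : StrictPartition n) (i j : ℕ) :
    (i, j) ∈ lam.subDelta ↔ ∃ h : i < n, j + (n - i) < lam.parts ⟨i, h⟩ := by
  rw [← YoungDiagram.mem_cells]
  simp only [subDelta, Finset.mem_biUnion, Finset.mem_univ, true_and, Finset.mem_image,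
    Finset.mem_range, Prod.mk.injEq]
  constructor
  · rintro ⟨k, b, hb, rfl, rfl⟩
    exact ⟨k.isLt, by simp only [Fin.eta]; omega⟩
  · rintro ⟨h, hj⟩
    exact ⟨⟨i, h⟩, j, by simp only; omega, rfl, rfl⟩

/-- `λ = μ + δ`. -/
theorem parts_eq (lam : StrictPartition n) (i : Fin n) :
    lam.parts i = lam.subDelta.rowLen i + (n - (i : ℕ)) := by
  have h1 := lam.delta_le i
  have key : ∀ j, j < lam.subDelta.rowLen i ↔ j + (n - (i : ℕ)) < lam.parts i := by
    intro j
    rw [← YoungDiagram.mem_iff_lt_rowLen, mem_subDelta]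
    simp [i.isLt]
  have h2 := key (lam.subDelta.rowLen i)
  have h3 := key (lam.parts i - (n - (i : ℕ)))
  omega

end StrictPartition

/-- Consecutive non-zero entries of `v` have opposite signs. -/
def AlternatesInSign {k : ℕ} (v : Fin k → ℤ) : Prop :=
  ∀ p q, p < q → v p ≠ 0 → v q ≠ 0 → (∀ r, p < r → r < q → v r = 0) → v q = -v p

/-- Membership of a matrix `A` with entries in `{1, 0, -1}` in `𝒜^λ`. The matrix has `n` rows and
`m = λ_1` columns; the column with index `j : Fin m` is the one numbered `j + 1`. -/
structure IsASM {n : ℕ} [NeZero n] (lam : StrictPartition n)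
    (A : Matrix (Fin n) (Fin (lam.parts 0)) ℤ) : Prop where
  alternates_row : ∀ i, AlternatesInSign fun j => A i j
  alternates_col : ∀ j, AlternatesInSign fun i => A i j
  rightmost : ∀ i j, A i j ≠ 0 → (∀ j', j < j' → A i j' = 0) → A i j = 1
  topmost : ∀ i j, A i j ≠ 0 → (∀ i', i' < i → A i' j = 0) → A i j = 1
  row_sum : ∀ i, ∑ j, A i j = 1
  col_sum_part : ∀ j : Fin (lam.parts 0), (∃ k, lam.parts k = (j : ℕ) + 1) → ∑ i, A i j = 1
  col_sum_nonpart : ∀ j : Fin (lam.parts 0), (¬ ∃ k, lam.parts k = (j : ℕ) + 1) → ∑ i, A i j = 0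

open Classical in
/-- The finite set `𝒜^λ`. -/
noncomputable def asmSet {n : ℕ} [NeZero n] (lam : StrictPartition n) :
    Finset (Matrix (Fin n) (Fin (lam.parts 0)) ℤ) :=
  (Fintype.piFinset fun _ : Fin n => Fintype.piFinset fun _ : Fin (lam.parts 0) =>
    ({1, 0, -1} : Finset ℤ)).filter fun A => IsASM lam A

/-- The six possible entries of a compass point matrix. -/
inductive CompassPoint
  | WE | NS | NE | SE | NW | SW
  deriving DecidableEq

/-- The nearest non-zero entry of `A` to the north of `(i, j)` is `1`
(false if there is no non-zero entry there: a missing neighbour counts as `-1`). -/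
def NorthIsOne {n m : ℕ} (A : Matrix (Fin n) (Fin m) ℤ) (i : Fin n) (j : Fin m) : Prop :=
  ∃ p, p < i ∧ A p j = 1 ∧ ∀ r, p < r → r < i → A r j = 0

/-- The nearest non-zero entry of `A` to the east of `(i, j)` is `1`
(false if there is no non-zero entry there: a missing neighbour counts as `-1`). -/
def EastIsOne {n m : ℕ} (A : Matrix (Fin n) (Fin m) ℤ) (i : Fin n) (j : Fin m) : Prop :=
  ∃ q, j < q ∧ A i q = 1 ∧ ∀ r, j < r → r < q → A i r = 0

instance {n m : ℕ} (A : Matrix (Fin n) (Fin m) ℤ) (i : Fin n) (j : Fin m) :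
    Decidable (NorthIsOne A i j) := by unfold NorthIsOne; infer_instance

instance {n m : ℕ} (A : Matrix (Fin n) (Fin m) ℤ) (i : Fin n) (j : Fin m) :
    Decidable (EastIsOne A i j) := by unfold EastIsOne; infer_instance

/-- The compass point matrix of `A`: an entry `1` becomes `WE`, an entry `-1` becomes `NS`, and an
entry `0` becomes `NW`, `NE`, `SW` or `SE` according to its nearest non-zero neighbours:
north `1` gives `N`, north `-1` gives `S`, east `1` gives `W`, east `-1` gives `E`.
(The signs of the neighbours to the south and west are then the opposite ones.) -/
def cpm {n m : ℕ} (A : Matrix (Fin n) (Fin m) ℤ) : Matrix (Fin n) (Fin m) CompassPoint :=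
  fun i j =>
    if A i j = 1 then .WE
    else if A i j = -1 then .NS
    else if NorthIsOne A i j then (if EastIsOne A i j then .NW else .NE)
    else (if EastIsOne A i j then .SW else .SE)

/-- The weight of a compass point in row `i` and in the column with index `j` (numbered `j + 1`);
`a k` is the parameter `a_k` for `k ≥ 1`. -/
def cpWeight {R : Type*} [CommRing R] {n : ℕ} (x y : Fin n → R) (a : ℕ → R)
    (i : Fin n) (j : ℕ) : CompassPoint → R
  | .WE => 1
  | .NS => x i + y i
  | .NE => 1
  | .SE => 1
  | .NW => y i - a (j + 1)
  | .SW => x i + a (j + 1)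

/-- The weight `∏ x_i ∏ wgt(c_{ij})` of `A`, where `(c_{ij})` is its compass point matrix. -/
def asmWeight {R : Type*} [CommRing R] {n m : ℕ} (x y : Fin n → R) (a : ℕ → R)
    (A : Matrix (Fin n) (Fin m) ℤ) : R :=
  (∏ i, x i) * ∏ i, ∏ j : Fin m, cpWeight x y a i j (cpm A i j)

/-- Semistandard tableaux of shape `μ` with entries in `{0, …, n-1}`;
the entry `k` stands for the letter `k + 1` of the alphabet `{1, …, n}`. -/
abbrev BoundedSSYT (μ : YoungDiagram) (n : ℕ) : Type :=
  {T : SemistandardYoungTableau μ // ∀ i j, (i, j) ∈ μ → T i j < n}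

instance (μ : YoungDiagram) (n : ℕ) : Finite (BoundedSSYT μ n) := by
  refine Finite.of_injective
    (fun T (c : {c // c ∈ μ.cells}) => (⟨T.1 c.1.1 c.1.2, T.2 _ _ ((YoungDiagram.mem_cells _).mp c.2)⟩ : Fin n)) ?_
  intro S T h
  refine Subtype.ext (SemistandardYoungTableau.ext fun i j => ?_)
  by_cases hc : (i, j) ∈ μ
  · simpa using congrFun h ⟨(i, j), (YoungDiagram.mem_cells _).mpr hc⟩
  · rw [S.1.zeros hc, T.1.zeros hc]

noncomputable instance (μ : YoungDiagram) (n : ℕ) : Fintype (BoundedSSYT μ n) :=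
  Fintype.ofFinite _

/-- No truncation occurs in the index of `a` in `factorialSchur`. -/
theorem row_le_entry {μ : YoungDiagram} (T : SemistandardYoungTableau μ) :
    ∀ i j, (i, j) ∈ μ → i ≤ T i j
  | 0, _, _ => Nat.zero_le _
  | i + 1, j, h => by
      have h1 := row_le_entry T i j (μ.up_left_mem (Nat.le_succ i) le_rfl h)
      exact Nat.succ_le_of_lt (lt_of_le_of_lt h1 (T.col_strict (Nat.lt_succ_self i) h))

/-- The factorial Schur function `s_μ(x|a) = ∑_T ∏_{(i,j)} (x_{T_{ij}} + a_{T_{ij}+j-i})`.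
All of `T_{ij}`, `i`, `j` are counted from `0` here, so that the index of `a`
is `(T_{ij} + 1) + (j + 1) - (i + 1)`. -/
noncomputable def factorialSchur {R : Type*} [CommRing R] {n : ℕ} (μ : YoungDiagram)
    (x : Fin n → R) (a : ℕ → R) : R :=
  ∑ T : BoundedSSYT μ n, ∏ c : {c // c ∈ μ.cells},
    (x ⟨T.1 c.1.1 c.1.2, T.2 _ _ ((YoungDiagram.mem_cells _).mp c.2)⟩
      + a (T.1 c.1.1 c.1.2 + 1 + c.1.2 - c.1.1))

/-! Write F_l(u) = ∏_{1≤k<l} (u + a_k). Both sides are expanded by removing the last index n, and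
both expansions are instances of one determinant recursion. The determinant is that of
`divDiffMatrix`, whose entry (i, j) is the divided difference of F_{λ_i} at x_j, …, x_n: the
bialternant of factorial powers with the Vandermonde product removed. Divided differences are built
from a recursion in l (`resolv`), so no division occurs and any commutative ring is allowed.

The last column consists of the F_{λ_i}(x_n). Subtracting from each row a multiple of the next
clears it except at the bottom, and each other row becomes a weighted sum over ν_i with λ_{i+1} ≤
ν_i ≤ λ_i. Multilinearity yields a sum over interlacing ν of smaller determinants (`det_bordered`),
with two free parameters α, β.

For α = 0, β = 1 the weight of ν is the product over the horizontal strip of boxes containing n, so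
the determinant is s_μ (`factorialSchur_eq_det`). Multiplying by ∏_{j<n} (x_j + y_n) changes the
parameters to α = 1, β = x_n + y_n, and then the weight of ν is that of the bottom row of an
alternating sign matrix, where ν records the column sums of the rows above (`prod_vertexWeight`,
`sum_stateWeight`). The passage to matrices described by sums rests on the fact that the sign
conditions say exactly that partial sums are 0 or 1. -/

/-! ### Factorial powers and divided differences. -/

section Algebra

variable {R : Type*} [CommRing R]

/-- The factorial power `∏_{1 ≤ j < l} (u + a_j)`. -/
def facPow (a : ℕ → R) (u : R) (l : ℕ) : R := ∏ j ∈ Finset.Ico 1 l, (u + a j)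

/-- The solution `ψ` of `ψ (l + 1) = (u + a_l) ψ l + φ l` with `ψ 1 = 0`. -/
def resolv (a : ℕ → R) (u : R) (φ : ℕ → R) (l : ℕ) : R :=
  ∑ k ∈ Finset.Ico 1 l, (∏ j ∈ Finset.Ico (k + 1) l, (u + a j)) * φ k

theorem facPow_mul_prod_Ico (a : ℕ → R) (u : R) {q p : ℕ} (hq : 1 ≤ q) (h : q ≤ p) :
    facPow a u q * ∏ j ∈ Finset.Ico q p, (u + a j) = facPow a u p :=
  Finset.prod_Ico_consecutive _ hq h

theorem facPow_succ (a : ℕ → R) (u : R) {l : ℕ} (h : 1 ≤ l) :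
    facPow a u (l + 1) = (u + a l) * facPow a u l := by
  rw [facPow, Finset.prod_Ico_succ_top h, mul_comm, facPow]

theorem resolv_eq_add (a : ℕ → R) (u : R) (φ : ℕ → R) {q p : ℕ} (hq : 1 ≤ q) (h : q ≤ p) :
    resolv a u φ p = (∏ j ∈ Finset.Ico q p, (u + a j)) * resolv a u φ q +
      ∑ k ∈ Finset.Ico q p, (∏ j ∈ Finset.Ico (k + 1) p, (u + a j)) * φ k := by
  rw [resolv, ← Finset.sum_Ico_consecutive _ hq h, resolv, Finset.mul_sum]
  congr 1
  refine Finset.sum_congr rfl fun k hk => ?_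
  rw [Finset.mem_Ico] at hk
  rw [← Finset.prod_Ico_consecutive _ (show k + 1 ≤ q by omega) h]
  ring

theorem resolv_succ (a : ℕ → R) (u : R) (φ : ℕ → R) {l : ℕ} (h : 1 ≤ l) :
    resolv a u φ (l + 1) = (u + a l) * resolv a u φ l + φ l := by
  rw [resolv_eq_add a u φ h (Nat.le_succ l)]
  simp

theorem resolv_add_mul (a : ℕ → R) (u : R) (φ ψ : ℕ → R) (c : R) (l : ℕ) :
    resolv a u (fun k => φ k + c * ψ k) l = resolv a u φ l + c * resolv a u ψ l := by
  simp only [resolv, mul_add, Finset.sum_add_distrib, Finset.mul_sum]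
  congr 1
  exact Finset.sum_congr rfl fun k _ => by ring

/-- As functions of l ≥ 1, both sides solve ψ(l + 1) = (v + a_l) ψ(l) with ψ(1) = 1. -/
theorem facPow_eq_add_resolv (a : ℕ → R) (u v : R) (l : ℕ) :
    facPow a v l = facPow a u l + (v - u) * resolv a v (facPow a u) l := by
  rcases Nat.eq_zero_or_pos l with rfl | h
  · simp [facPow, resolv]
  · induction l, h using Nat.le_induction with
    | base => simp [facPow, resolv]
    | succ l h ih =>
      rw [facPow_succ a v h, facPow_succ a u h, resolv_succ a v _ h, ih]
      ring

/-- The resolvent identity. -/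
theorem resolv_eq_add_resolv (a : ℕ → R) (u v : R) (φ : ℕ → R) (l : ℕ) :
    resolv a v φ l = resolv a u φ l + (v - u) * resolv a v (resolv a u φ) l := by
  rcases Nat.eq_zero_or_pos l with rfl | h
  · simp [resolv]
  · induction l, h using Nat.le_induction with
    | base => simp [resolv]
    | succ l h ih =>
      rw [resolv_succ a v _ h, resolv_succ a u _ h, resolv_succ a v _ h, ih]
      ring

/-- The divided difference at `x_j, …, x_{j+d}` of `u ↦ facPow a u l`. -/
def divDiff (a x : ℕ → R) (j : ℕ) : ℕ → ℕ → R
  | 0 => facPow a (x j)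
  | d + 1 => resolv a (x (j + d + 1)) (divDiff a x j d)

/-- The usual quotient rule with the denominator cleared. The definition adjoins nodes only on the
right; the resolvent identity, applied to the last two nodes, is what allows the first node to be
dropped, and the two differences of nodes telescope. -/
theorem divDiff_succ_left (a x : ℕ → R) (j d l : ℕ) :
    divDiff a x (j + 1) d l =
      divDiff a x j d l + (x (j + d + 1) - x j) * divDiff a x j (d + 1) l := by
  induction d generalizing l with
  | zero => exact facPow_eq_add_resolv a (x j) (x (j + 1)) l
  | succ d ih =>
    have h : j + 1 + d + 1 = j + (d + 1) + 1 := by ring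
    rw [divDiff, funext ih, h, resolv_add_mul,
      resolv_eq_add_resolv a (x (j + d + 1)) (x (j + (d + 1) + 1))]
    simp only [divDiff]
    have h' : j + (d + 1) = j + d + 1 := by ring
    simp only [h']
    ring

/-! ### Determinants as sums over interlacing sequences. -/

/-- The matrix of divided differences whose determinant is a factorial Schur function. -/
def divDiffMatrix (a x : ℕ → R) (n : ℕ) (lam : Fin n → ℕ) : Matrix (Fin n) (Fin n) R :=
  Matrix.of fun i j => divDiff a x j (n - 1 - j) (lam i)

/-- The strictly decreasing sequences interlacing with `lam`. -/
def interlacing {n : ℕ} (lam : Fin (n + 1) → ℕ) : Finset (Fin n → ℕ) :=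
  (Fintype.piFinset fun i => Finset.Icc (lam i.succ) (lam i.castSucc)).filter
    fun nu => ∀ i j, i < j → nu j < nu i

theorem mem_interlacing {n : ℕ} {lam : Fin (n + 1) → ℕ} {nu : Fin n → ℕ} :
    nu ∈ interlacing lam ↔
      (∀ i, lam i.succ ≤ nu i ∧ nu i ≤ lam i.castSucc) ∧ StrictAnti nu := by
  simp only [interlacing, Finset.mem_filter, Fintype.mem_piFinset, Finset.mem_Icc]
  rfl

/-- The weight contributed by a part `k` between consecutive parts `q < p`. -/
def stripWeight (α β : R) (a : ℕ → R) (u : R) (p q k : ℕ) : R :=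
  if k = p then α
  else (if k = q then β - α * (u + a k) else β) * ∏ j ∈ Finset.Ico (k + 1) p, (u + a j)

/-- `stripWeight` is read off from the right side, a row at p minus a multiple of the row at q: the
part of `resolv` below q cancels, and k = q collects β from the remaining tail and -α(u + a_q) from
the subtracted row. -/
theorem sum_stripWeight (α β : R) (a : ℕ → R) (u : R) (φ : ℕ → R) {q p : ℕ}
    (hq : 1 ≤ q) (h : q < p) :
    ∑ k ∈ Finset.Icc q p, stripWeight α β a u p q k * φ k =
      α * φ p + β * resolv a u φ p -
        (∏ j ∈ Finset.Ico q p, (u + a j)) * (α * φ q + β * resolv a u φ q) := by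
  rw [← Finset.Ico_succ_right_eq_Icc, Nat.succ_eq_succ, Nat.succ_eq_add_one,
    Finset.sum_Ico_succ_top h.le, Finset.sum_eq_sum_Ico_succ_bot h, resolv_eq_add a u φ hq h.le,
    Finset.sum_eq_sum_Ico_succ_bot h, Finset.prod_eq_prod_Ico_succ_bot h]
  have h1 : ∑ k ∈ Finset.Ico (q + 1) p, stripWeight α β a u p q k * φ k =
      β * ∑ k ∈ Finset.Ico (q + 1) p, (∏ j ∈ Finset.Ico (k + 1) p, (u + a j)) * φ k := by
    rw [Finset.mul_sum]
    refine Finset.sum_congr rfl fun k hk => ?_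
    rw [Finset.mem_Ico] at hk
    rw [stripWeight, if_neg (by omega), if_neg (by omega)]
    ring
  rw [h1, stripWeight, if_neg h.ne, if_pos rfl, stripWeight, if_pos rfl]
  ring

theorem det_sum_rows {n : ℕ} (s : Fin n → Finset ℕ) (w : Fin n → ℕ → R) (φ : Fin n → ℕ → R) :
    (Matrix.of fun i j => ∑ k ∈ s i, w i k * φ j k).det =
      ∑ nu ∈ Fintype.piFinset s, (∏ i, w i (nu i)) * (Matrix.of fun i j => φ j (nu i)).det := by
  have h := (Matrix.detRowAlternating (n := Fin n) (R := R)).toMultilinearMap.map_sum_finset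
    (fun i k => w i k • fun j => φ j k) s
  have h0 : (Matrix.of fun i j => ∑ k ∈ s i, w i k * φ j k) =
      fun i => ∑ k ∈ s i, w i k • fun j => φ j k := by
    ext i j
    simp [Finset.sum_apply]
  rw [h0]
  refine h.trans (Finset.sum_congr rfl fun nu _ => ?_)
  exact (Matrix.detRowAlternating (n := Fin n) (R := R)).toMultilinearMap.map_smul_univ _ _

theorem det_sub_next_row {n : ℕ} (A : Matrix (Fin (n + 1)) (Fin (n + 1)) R) (c : Fin n → R) :
    A.det = (Matrix.of (Fin.snoc (α := fun _ => Fin (n + 1) → R)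
      (fun i => A i.castSucc - c i • A i.succ) (A (Fin.last n)))).det := by
  -- Reversing the order of the rows turns the next row into the preceding one.
  rw [← Matrix.det_submatrix_equiv_self Fin.revPerm A,
    ← Matrix.det_submatrix_equiv_self Fin.revPerm (Matrix.of _)]
  refine Matrix.det_eq_of_forall_row_eq_smul_add_pred (fun i => c i.rev) (fun j => ?_)
    fun i j => ?_
  · simp [Fin.rev_zero]
  · simp [Fin.rev_succ, Fin.rev_castSucc]

/-- Consecutive entries of the last column have ratio ∏_{λ_{i+1} ≤ j < λ_i} (u + a_j), so row
operations with these factors leave only its bottom entry. The remaining minor is expanded by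
linearity in each row. -/
theorem det_bordered {n : ℕ} (α β : R) (a : ℕ → R) (u : R) (lam : Fin (n + 1) → ℕ)
    (hlam : StrictAnti lam) (hpos : ∀ i, 0 < lam i) (φ : Fin n → ℕ → R) :
    (Matrix.of fun i => Fin.snoc (α := fun _ => R)
        (fun j => α * φ j (lam i) + β * resolv a u (φ j) (lam i)) (facPow a u (lam i))).det =
      facPow a u (lam (Fin.last n)) * ∑ nu ∈ interlacing lam,
        (∏ i, stripWeight α β a u (lam i.castSucc) (lam i.succ) (nu i)) *
          (Matrix.of fun i j => φ j (nu i)).det := by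
  have hlt : ∀ i : Fin n, lam i.succ < lam i.castSucc := fun i => hlam Fin.castSucc_lt_succ
  rw [det_sub_next_row _ fun i => ∏ j ∈ Finset.Ico (lam i.succ) (lam i.castSucc), (u + a j),
    Matrix.det_succ_column _ (Fin.last n), Fin.sum_univ_castSucc, Finset.sum_eq_zero, zero_add]
  · have hsub : ∀ M : Matrix (Fin (n + 1)) (Fin (n + 1)) R, (-1 : R) ^ (Fin.last n + Fin.last n : ℕ)
        * M (Fin.last n) (Fin.last n) *
          (M.submatrix (Fin.last n).succAbove (Fin.last n).succAbove).det =
        M (Fin.last n) (Fin.last n) * (M.submatrix Fin.castSucc Fin.castSucc).det := by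
      intro M
      rw [← two_mul, pow_mul, neg_one_sq, one_pow, one_mul, Fin.succAbove_last]
    rw [hsub]
    congr 1
    · simp
    · have h1 := det_sum_rows (fun i : Fin n => Finset.Icc (lam i.succ) (lam i.castSucc))
        (fun i k => stripWeight α β a u (lam i.castSucc) (lam i.succ) k) φ
      rw [interlacing, Finset.sum_filter_of_ne, ← h1]
      · congr 1
        ext i j
        simp [sum_stripWeight α β a u (φ j) (hpos i.succ) (hlt i)]
      -- The bounds make ν weakly decreasing; a repeated value gives two equal rows and a vanishing
      -- determinant.
      · intro nu hnu hne i j hij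
        simp only [Fintype.mem_piFinset, Finset.mem_Icc] at hnu
        refine lt_of_le_of_ne ?_ fun he => hne ?_
        · exact (hnu j).2.trans ((hlam.antitone (Fin.succ_le_castSucc_iff.mpr hij)).trans (hnu i).1)
        · rw [Matrix.det_zero_of_row_eq hij.ne, mul_zero]
          ext k
          simp [he]
  · intro i _
    have := facPow_mul_prod_Ico a u (hpos i.succ) (hlt i).le
    simp [← this, mul_comm]

theorem det_divDiffMatrix_succ (a x : ℕ → R) (n : ℕ) (lam : Fin (n + 1) → ℕ)
    (hlam : StrictAnti lam) (hpos : ∀ i, 0 < lam i) :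
    (divDiffMatrix a x (n + 1) lam).det =
      facPow a (x n) (lam (Fin.last n)) * ∑ nu ∈ interlacing lam,
        (∏ i, stripWeight 0 1 a (x n) (lam i.castSucc) (lam i.succ) (nu i)) *
          (divDiffMatrix a x n nu).det := by
  have h := det_bordered 0 1 a (x n) lam hlam hpos fun j : Fin n => divDiff a x j (n - 1 - j)
  refine Eq.trans ?_ h
  congr 1
  ext i j
  refine Fin.lastCases ?_ (fun j => ?_) j
  · simp [divDiffMatrix, divDiff]
  · have hj : n - (j : ℕ) = n - 1 - j + 1 := by omega
    have hj' : (j : ℕ) + (n - 1 - j) + 1 = n := by omega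
    simp only [divDiffMatrix, Matrix.of_apply, Fin.snoc_castSucc, Fin.val_castSucc,
      add_tsub_cancel_right, hj, divDiff, hj', zero_mul, zero_add, one_mul]

/-- By `divDiff_succ_left`, (x_j + y) f[x_j..x_n] + f[x_{j+1}..x_n] = f[x_j..x_{n-1}] + (x_n + y)
f[x_j..x_n], which is the column required by `det_bordered` with α = 1 and β = x_n + y. -/
theorem prod_mul_det_divDiffMatrix_succ (a x : ℕ → R) (y : R) (n : ℕ) (lam : Fin (n + 1) → ℕ)
    (hlam : StrictAnti lam) (hpos : ∀ i, 0 < lam i) :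
    (∏ j : Fin n, (x j + y)) * (divDiffMatrix a x (n + 1) lam).det =
      facPow a (x n) (lam (Fin.last n)) * ∑ nu ∈ interlacing lam,
        (∏ i, stripWeight 1 (x n + y) a (x n) (lam i.castSucc) (lam i.succ) (nu i)) *
          (divDiffMatrix a x n nu).det := by
  have h := det_bordered 1 (x n + y) a (x n) lam hlam hpos
    fun j : Fin n => divDiff a x j (n - 1 - j)
  refine Eq.trans ?_ h
  -- Lower bidiagonal: right multiplication by `T` adds column j + 1 to x_j + y times column j and
  -- keeps the last column.
  let T : Matrix (Fin (n + 1)) (Fin (n + 1)) R := Matrix.of fun k =>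
    Fin.snoc (α := fun _ => R)
      (fun j => (if k = j.castSucc then x j + y else 0) + if k = j.succ then 1 else 0)
      (if k = Fin.last n then 1 else 0)
  have hT : T.det = ∏ j : Fin n, (x j + y) := by
    rw [Matrix.det_of_isLowerTriangular, Fin.prod_univ_castSucc]
    · simp [T, Fin.castSucc_lt_succ.ne]
    · intro k j hkj
      change k < j at hkj
      revert hkj
      refine Fin.lastCases (fun hkj => ?_) (fun j hkj => ?_) j
      · simp [T, hkj.ne]
      · simp [T, hkj.ne, (hkj.trans Fin.castSucc_lt_succ).ne]
  rw [← hT, mul_comm, ← Matrix.det_mul]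
  congr 1
  ext i j
  rw [Matrix.mul_apply]
  refine Fin.lastCases ?_ (fun j => ?_) j
  · simp [T, divDiffMatrix, divDiff]
  · have hj : n - (j : ℕ) = n - 1 - j + 1 := by omega
    have hj' : (j : ℕ) + (n - 1 - j) + 1 = n := by omega
    have hj'' : n - ((j : ℕ) + 1) = n - 1 - j := by omega
    have hs := divDiff_succ_left a x j (n - 1 - j) (lam i)
    rw [hj'] at hs
    simp only [T, divDiffMatrix, Matrix.of_apply, Fin.snoc_castSucc, mul_add, Finset.sum_add_distrib,
      mul_ite, mul_zero, mul_one, Finset.sum_ite_eq', Finset.mem_univ, if_true,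
      Fin.val_castSucc, Fin.val_succ, add_tsub_cancel_right, hj, hj'', hs, divDiff, hj']
    ring

end Algebra

/-! ### Alternating sign sequences through partial sums. -/

section SignSequences

variable {k : ℕ}

/-- The sum of the entries of `v` with index less than `t`. -/
def prefixSum (v : Fin k → ℤ) (t : ℕ) : ℤ := ∑ i : Fin k, if (i : ℕ) < t then v i else 0

/-- The sum of the entries of `v` with index at least `t`. -/
def suffixSum (v : Fin k → ℤ) (t : ℕ) : ℤ := ∑ i : Fin k, if t ≤ (i : ℕ) then v i else 0

/-- The last non-zero entry of `v` before position `t` exists and is `c`. -/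
def LastNonzeroIs (v : Fin k → ℤ) (t : ℕ) (c : ℤ) : Prop :=
  ∃ p : Fin k, (p : ℕ) < t ∧ v p = c ∧ ∀ r, p < r → (r : ℕ) < t → v r = 0

theorem prefixSum_zero (v : Fin k → ℤ) : prefixSum v 0 = 0 := by simp [prefixSum]

theorem prefixSum_succ (v : Fin k → ℤ) (t : Fin k) :
    prefixSum v (t + 1) = prefixSum v t + v t := by
  have : v t = ∑ i, if i = t then v i else 0 := by simp
  rw [this, prefixSum, prefixSum, ← Finset.sum_add_distrib]
  refine Finset.sum_congr rfl fun i _ => ?_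
  by_cases h : i = t
  · simp [h]
  · have h' : (i : ℕ) ≠ t := fun he => h (Fin.ext he)
    simp only [if_neg h, add_zero]
    exact if_congr (by omega) rfl rfl

theorem prefixSum_of_le (v : Fin k → ℤ) {t : ℕ} (h : k ≤ t) : prefixSum v t = ∑ i, v i :=
  Finset.sum_congr rfl fun i _ => if_pos (i.isLt.trans_le h)

theorem suffixSum_zero (v : Fin k → ℤ) : suffixSum v 0 = ∑ i, v i := by simp [suffixSum]

theorem suffixSum_eq_prefixSum_rev (v : Fin k → ℤ) (t : ℕ) :
    suffixSum v t = prefixSum (v ∘ Fin.rev) (k - t) := by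
  rw [suffixSum, prefixSum, ← Equiv.sum_comp Fin.revPerm]
  refine Finset.sum_congr rfl fun i _ => if_congr ?_ rfl rfl
  simp only [Fin.revPerm_apply, Fin.val_rev]
  omega

theorem prefixSum_rev_eq_suffixSum (v : Fin k → ℤ) (t : ℕ) :
    prefixSum (v ∘ Fin.rev) t = suffixSum v (k - t) := by
  rw [suffixSum, prefixSum, ← Equiv.sum_comp Fin.revPerm]
  refine Finset.sum_congr rfl fun i _ => if_congr ?_ (by simp) rfl
  simp only [Fin.revPerm_apply, Fin.val_rev]
  omega

theorem LastNonzeroIs.of_eq_zero {v : Fin k → ℤ} {t : Fin k} {c : ℤ} (h : LastNonzeroIs v t c)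
    (ht : v t = 0) : LastNonzeroIs v (t + 1) c := by
  obtain ⟨p, hp, hv, hr⟩ := h
  refine ⟨p, by omega, hv, fun r h1 h2 => ?_⟩
  rcases Nat.lt_succ_iff_lt_or_eq.mp h2 with h3 | h3
  · exact hr r h1 h3
  · rwa [Fin.ext h3]

theorem lastNonzeroIs_succ (v : Fin k → ℤ) (t : Fin k) : LastNonzeroIs v (t + 1) (v t) :=
  ⟨t, by omega, rfl, fun r h1 h2 => absurd h1 (by rw [Fin.lt_def]; omega)⟩

theorem LastNonzeroIs.unique {v : Fin k → ℤ} {t : ℕ} {c d : ℤ} (hc : LastNonzeroIs v t c)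
    (hd : LastNonzeroIs v t d) (hc0 : c ≠ 0) (hd0 : d ≠ 0) : c = d := by
  obtain ⟨p, hp, rfl, hpr⟩ := hc
  obtain ⟨q, hq, rfl, hqr⟩ := hd
  rcases lt_trichotomy p q with h | rfl | h
  · exact absurd (hpr q h hq) hd0
  · rfl
  · exact absurd (hqr p h hp) hc0

theorem AlternatesInSign.eq_neg {v : Fin k → ℤ} (h : AlternatesInSign v) {t : Fin k} {c : ℤ}
    (hc : LastNonzeroIs v t c) (hc0 : c ≠ 0) (ht : v t ≠ 0) : v t = -c := by
  obtain ⟨p, hp, rfl, hr⟩ := hc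
  exact h p t hp hc0 ht fun r h1 h2 => hr r h1 h2

theorem prefixSum_of_alternates {v : Fin k → ℤ} (he : ∀ i, v i = 1 ∨ v i = 0 ∨ v i = -1)
    (ha : AlternatesInSign v) (hf : ∀ i, v i ≠ 0 → (∀ i', i' < i → v i' = 0) → v i = 1) :
    ∀ t ≤ k, (prefixSum v t = 0 ∧ ((∀ i : Fin k, (i : ℕ) < t → v i = 0) ∨ LastNonzeroIs v t (-1))) ∨
      (prefixSum v t = 1 ∧ LastNonzeroIs v t 1)
  | 0, _ => Or.inl ⟨prefixSum_zero v, Or.inl fun i hi => absurd hi (Nat.not_lt_zero _)⟩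
  | t + 1, ht => by
    obtain ⟨s, rfl⟩ : ∃ s : Fin k, (s : ℕ) = t := ⟨⟨t, ht⟩, rfl⟩
    have ih := prefixSum_of_alternates he ha hf s (by omega)
    have hl := lastNonzeroIs_succ v s
    rw [prefixSum_succ]
    rcases he s with h | h | h
    · rw [h] at hl ⊢
      rcases ih with ⟨h0, _⟩ | ⟨_, h1⟩
      · exact Or.inr ⟨by omega, hl⟩
      · have := ha.eq_neg h1 one_ne_zero (by omega)
        omega
    · rcases ih with ⟨h0, h1 | h1⟩ | ⟨h0, h1⟩
      · refine Or.inl ⟨by omega, Or.inl fun i hi => ?_⟩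
        rcases Nat.lt_succ_iff_lt_or_eq.mp hi with h3 | h3
        · exact h1 i h3
        · rwa [Fin.ext h3]
      · exact Or.inl ⟨by omega, Or.inr (h1.of_eq_zero h)⟩
      · exact Or.inr ⟨by omega, h1.of_eq_zero h⟩
    · rw [h] at hl ⊢
      rcases ih with ⟨_, h1 | h1⟩ | ⟨h0, _⟩
      · have := hf s (by omega) fun i hi => h1 i hi
        omega
      · have := ha.eq_neg h1 (by omega) (by omega)
        omega
      · exact Or.inl ⟨by omega, Or.inr hl⟩

theorem lastNonzeroIs_of_prefixSum {v : Fin k → ℤ}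
    (h : ∀ t, prefixSum v t = 0 ∨ prefixSum v t = 1) :
    ∀ t ≤ k, (prefixSum v t = 1 → LastNonzeroIs v t 1) ∧
      (prefixSum v t = 0 → (∀ i : Fin k, (i : ℕ) < t → v i = 0) ∨ LastNonzeroIs v t (-1))
  | 0, _ => ⟨fun h => by simp [prefixSum_zero] at h,
      fun _ => Or.inl fun i hi => absurd hi (Nat.not_lt_zero _)⟩
  | t + 1, ht => by
    obtain ⟨s, rfl⟩ : ∃ s : Fin k, (s : ℕ) = t := ⟨⟨t, ht⟩, rfl⟩
    obtain ⟨ih1, ih0⟩ := lastNonzeroIs_of_prefixSum h s (by omega)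
    have hl := lastNonzeroIs_succ v s
    rw [prefixSum_succ]
    constructor
    · intro h1
      rcases h s with h2 | h2
      · rwa [show v s = 1 by omega] at hl
      · exact (ih1 h2).of_eq_zero (by omega)
    · intro h1
      rcases h s with h2 | h2
      · rcases ih0 h2 with h3 | h3
        · refine Or.inl fun i hi => ?_
          rcases Nat.lt_succ_iff_lt_or_eq.mp hi with h4 | h4
          · exact h3 i h4
          · rw [Fin.ext h4]
            omega
        · exact Or.inr (h3.of_eq_zero (by omega))
      · rw [show v s = -1 by omega] at hl
        exact Or.inr hl

theorem lastNonzeroIs_one_iff {v : Fin k → ℤ} (h : ∀ t, prefixSum v t = 0 ∨ prefixSum v t = 1)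
    {t : ℕ} (ht : t ≤ k) : LastNonzeroIs v t 1 ↔ prefixSum v t = 1 := by
  obtain ⟨h1, h0⟩ := lastNonzeroIs_of_prefixSum h t ht
  refine ⟨fun hl => (h t).resolve_left fun h2 => ?_, h1⟩
  rcases h0 h2 with h3 | h3
  · obtain ⟨p, hp, hv, _⟩ := hl
    have := h3 p hp
    omega
  · have := hl.unique h3 (by omega) (by omega)
    omega

/-- A partial sum is 1 when the last non-zero entry so far is 1, and 0 when that entry is -1 or
missing. This also matches the convention that a missing neighbour counts as -1. -/
theorem alternates_iff_prefixSum (v : Fin k → ℤ) :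
    ((∀ i, v i = 1 ∨ v i = 0 ∨ v i = -1) ∧ AlternatesInSign v ∧
      ∀ i, v i ≠ 0 → (∀ i', i' < i → v i' = 0) → v i = 1) ↔
      ∀ t, prefixSum v t = 0 ∨ prefixSum v t = 1 := by
  constructor
  · rintro ⟨he, ha, hf⟩ t
    have h := prefixSum_of_alternates he ha hf
    rcases le_total t k with ht | ht
    · exact (h t ht).imp And.left And.left
    · have := (h k le_rfl).imp And.left And.left
      rwa [prefixSum_of_le v le_rfl, ← prefixSum_of_le v ht] at this
  · intro h
    have hs : ∀ i : Fin k, v i = prefixSum v (i + 1) - prefixSum v i := fun i => by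
      rw [prefixSum_succ]
      ring
    refine ⟨fun i => ?_, fun p q hpq hp hq hr => ?_, fun i hi hz => ?_⟩
    · have := hs i
      have := h i
      have := h (i + 1)
      omega
    · have hl : LastNonzeroIs v q (v p) := ⟨p, hpq, rfl, fun r h1 h2 => hr r h1 h2⟩
      have h1 := lastNonzeroIs_one_iff h q.isLt.le
      have := hs q
      have := h (q + 1)
      have hp' : v p = 1 ∨ v p = -1 := by
        have := hs p
        have := h p
        have := h (p + 1)
        omega
      rcases hp' with hp' | hp'
      · rw [hp'] at hl ⊢
        have := h1.mp hl
        omega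
      · rw [hp'] at hl ⊢
        have : ¬ prefixSum v q = 1 := fun h2 => by
          have := hl.unique (h1.mpr h2) (by omega) (by omega)
          omega
        have := h q
        omega
    · have : prefixSum v i = 0 := Finset.sum_eq_zero fun j _ => by
        split_ifs with hj
        · exact hz j hj
        · rfl
      have := hs i
      have := h (i + 1)
      omega

theorem alternatesInSign_comp_rev {v : Fin k → ℤ} :
    AlternatesInSign (v ∘ Fin.rev) ↔ AlternatesInSign v := by
  have key : ∀ w : Fin k → ℤ, AlternatesInSign w → AlternatesInSign (w ∘ Fin.rev) := by
    intro w hw p q hpq hp hq hr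
    have := hw q.rev p.rev (Fin.rev_lt_rev.mpr hpq) hq hp fun r h1 h2 => by
      have := hr r.rev (by rwa [Fin.lt_rev_iff]) (by rwa [Fin.rev_lt_iff])
      simpa using this
    simp only [Function.comp_apply]
    omega
  refine ⟨fun h => ?_, key v⟩
  have := key _ h
  rwa [Function.comp_assoc, Fin.rev_involutive.comp_self, Function.comp_id] at this

theorem alternates_iff_suffixSum (v : Fin k → ℤ) :
    ((∀ i, v i = 1 ∨ v i = 0 ∨ v i = -1) ∧ AlternatesInSign v ∧
      ∀ i, v i ≠ 0 → (∀ i', i < i' → v i' = 0) → v i = 1) ↔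
      ∀ t, suffixSum v t = 0 ∨ suffixSum v t = 1 := by
  have h := alternates_iff_prefixSum (v ∘ Fin.rev)
  rw [alternatesInSign_comp_rev] at h
  have h1 : (∀ t, prefixSum (v ∘ Fin.rev) t = 0 ∨ prefixSum (v ∘ Fin.rev) t = 1) ↔
      ∀ t, suffixSum v t = 0 ∨ suffixSum v t = 1 :=
    ⟨fun h t => by rw [suffixSum_eq_prefixSum_rev]; exact h _,
      fun h t => by rw [prefixSum_rev_eq_suffixSum]; exact h _⟩
  rw [← h1, ← h]
  refine and_congr Fin.rev_surjective.forall (and_congr Iff.rfl ?_)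
  rw [Fin.rev_surjective.forall]
  refine forall_congr' fun i => imp_congr Iff.rfl (imp_congr ?_ Iff.rfl)
  rw [Fin.rev_surjective.forall]
  simp

end SignSequences

/-! ### Interlacing and the weight of a single row. -/

section RowCombinatorics

variable {n : ℕ}

/-- The indicator of the set of parts of `lam`. -/
def partIndicator (lam : Fin n → ℕ) (c : ℕ) : ℤ := if ∃ k, lam k = c then 1 else 0

/-- The number of parts of `lam` exceeding `t`. -/
def countGT (lam : Fin n → ℕ) (t : ℕ) : ℕ := (Finset.univ.filter fun k => t < lam k).card

theorem partIndicator_eq_one {lam : Fin n → ℕ} {c : ℕ} (k : Fin n) (h : lam k = c) :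
    partIndicator lam c = 1 := if_pos ⟨k, h⟩

theorem partIndicator_eq_zero {lam : Fin n → ℕ} {c : ℕ} (h : ∀ k, lam k ≠ c) :
    partIndicator lam c = 0 := if_neg fun ⟨k, hk⟩ => h k hk

theorem partIndicator_cases (lam : Fin n → ℕ) (c : ℕ) :
    partIndicator lam c = 0 ∨ partIndicator lam c = 1 := by
  unfold partIndicator
  split_ifs <;> simp

theorem lt_countGT {lam : Fin n → ℕ} (hlam : StrictAnti lam) (i : Fin n) (t : ℕ) :
    (i : ℕ) < countGT lam t ↔ t < lam i := by
  constructor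
  · intro h
    by_contra hc
    refine absurd h (not_lt.mpr ?_)
    rw [countGT, ← Fin.card_Iio i]
    refine Finset.card_le_card fun k hk => ?_
    rw [Finset.mem_filter] at hk
    rw [Finset.mem_Iio]
    by_contra hki
    have := hlam.antitone (not_lt.mp hki)
    omega
  · intro h
    rw [Nat.lt_iff_add_one_le, countGT, ← Fin.card_Iic i]
    refine Finset.card_le_card fun k hk => ?_
    rw [Finset.mem_Iic] at hk
    rw [Finset.mem_filter]
    exact ⟨Finset.mem_univ _, h.trans_le (hlam.antitone hk)⟩

theorem countGT_le (lam : Fin n → ℕ) (t : ℕ) : countGT lam t ≤ n := by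
  simpa [countGT] using Finset.card_filter_le (Finset.univ : Finset (Fin n)) fun k => t < lam k

/-- Column index j carries the number j + 1, so indices at least t correspond to parts exceeding t.
-/
theorem suffixSum_partIndicator {lam : Fin n → ℕ} (hlam : StrictAnti lam) {m : ℕ}
    (hm : ∀ k, 0 < lam k ∧ lam k ≤ m) (t : ℕ) :
    suffixSum (fun j : Fin m => partIndicator lam (j + 1)) t = countGT lam t := by
  have h1 : ∀ c, partIndicator lam c = ∑ k, if lam k = c then 1 else 0 := by
    intro c
    by_cases h : ∃ k, lam k = c
    · obtain ⟨k, rfl⟩ := h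
      simp [partIndicator_eq_one k, hlam.injective.eq_iff]
    · push Not at h
      simp [partIndicator_eq_zero h, h]
  rw [suffixSum, countGT, Finset.card_filter, Nat.cast_sum]
  simp only [h1]
  have h2 : ∀ j : Fin m, (if t ≤ (j : ℕ) then ∑ k, if lam k = j + 1 then (1 : ℤ) else 0 else 0) =
      ∑ k, if t ≤ (j : ℕ) ∧ lam k = j + 1 then (1 : ℤ) else 0 := by
    intro j
    by_cases h : t ≤ (j : ℕ) <;> simp [h]
  rw [Finset.sum_congr rfl fun j _ => h2 j, Finset.sum_comm]
  refine Finset.sum_congr rfl fun k _ => ?_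
  obtain ⟨h3, h4⟩ := hm k
  rw [Finset.sum_eq_single (⟨lam k - 1, by omega⟩ : Fin m)]
  · push_cast
    exact if_congr (by omega) rfl rfl
  · intro j _ hj
    refine if_neg fun h => hj (Fin.ext ?_)
    simp only
    omega
  · simp

theorem suffixSum_sub {m : ℕ} (v w : Fin m → ℤ) (t : ℕ) :
    suffixSum (fun j => v j - w j) t = suffixSum v t - suffixSum w t := by
  rw [suffixSum, suffixSum, suffixSum, ← Finset.sum_sub_distrib]
  refine Finset.sum_congr rfl fun i _ => ?_
  split_ifs <;> simp

/-- The difference of the two counts is a suffix sum of the bottom row, so interlacing is the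
condition that these sums be 0 or 1. -/
theorem interlacing_iff_countGT {lam : Fin (n + 1) → ℕ} (hlam : StrictAnti lam)
    {nu : Fin n → ℕ} (hnu : StrictAnti nu) :
    nu ∈ interlacing lam ↔
      ∀ t, countGT nu t ≤ countGT lam t ∧ countGT lam t ≤ countGT nu t + 1 := by
  rw [mem_interlacing]
  constructor
  · rintro ⟨h, -⟩ t
    constructor
    · by_contra hc
      have hn := countGT_le nu t
      have h1 := (lt_countGT hnu ⟨countGT lam t, by omega⟩ t).mp (by simp only; omega)
      have h2 := (lt_countGT hlam _ t).mpr (h1.trans_le (h _).2)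
      simp at h2
    · by_contra hc
      have hn := countGT_le lam t
      let i : Fin n := ⟨countGT nu t, by omega⟩
      have h1 := (lt_countGT hlam i.succ t).mp (by simp only [Fin.val_succ, i]; omega)
      have h2 := (lt_countGT hnu i t).mpr (h1.trans_le (h i).1)
      simp [i] at h2
  · refine fun h => ⟨fun i => ⟨?_, ?_⟩, hnu⟩
    · by_contra hc
      have h1 := (lt_countGT hlam i.succ (nu i)).mpr (by omega)
      have h2 := (h (nu i)).2
      rw [Fin.val_succ] at h1
      have := (lt_countGT hnu i (nu i)).mp (by omega)
      omega
    · by_contra hc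
      have h1 := (lt_countGT hnu i (lam i.castSucc)).mpr (by omega)
      have h2 := (h (lam i.castSucc)).1
      have := (lt_countGT hlam i.castSucc (lam i.castSucc)).mp (by
        rw [Fin.val_castSucc]
        omega)
      omega

theorem prod_Ico_antitone {M : Type*} [CommMonoid M] (F : ℕ → M) :
    ∀ {n : ℕ} (lam : Fin (n + 1) → ℕ), Antitone lam →
      ∏ c ∈ Finset.Ico (lam (Fin.last n)) (lam 0), F c =
        ∏ i : Fin n, ∏ c ∈ Finset.Ico (lam i.succ) (lam i.castSucc), F c
  | 0, lam, _ => by simp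
  | n + 1, lam, h => by
    have ih := prod_Ico_antitone F (fun i => lam i.succ) fun i j hij =>
      h (Fin.succ_le_succ_iff.mpr hij)
    rw [Fin.prod_univ_succ, ← Finset.prod_Ico_consecutive F (h (Fin.le_last 1)) (h (Fin.zero_le 1)),
      mul_comm]
    exact congrArg _ ih

variable {R : Type*} [CommRing R]

/-- The weight of a vertex whose entry is `e`, where `c` is the sum of the entries to the north
and `r` the sum of the entries to the east. -/
def vertexWeight (u w b : R) (e c r : ℤ) : R :=
  if e = 1 then 1 else if e = -1 then u + w
  else if c = 1 then (if r = 1 then w - b else 1) else (if r = 1 then u + b else 1)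

theorem vertexWeight_east_zero (u w b : R) {e : ℤ} (c : ℤ) (he : e ≠ -1) :
    vertexWeight u w b e c 0 = 1 := by
  simp [vertexWeight, he]

/-- Cut the columns at the parts of λ. From λ_1 on all weights are 1; below the least part every
vertex is SW, giving the factorial power; each interval [λ_{i+1}, λ_i) contributes 1 before ν_i, a
special factor at ν_i, and SW factors after it. -/
theorem prod_vertexWeight {lam : Fin (n + 1) → ℕ} (hlam : StrictAnti lam) {m : ℕ}
    (hm : ∀ k, 0 < lam k ∧ lam k ≤ m) {nu : Fin n → ℕ} (hnu : nu ∈ interlacing lam)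
    (u w : R) (a : ℕ → R) :
    ∏ j : Fin m, vertexWeight u w (a (j + 1))
        (partIndicator lam (j + 1) - partIndicator nu (j + 1)) (partIndicator nu (j + 1))
        (countGT lam (j + 1) - countGT nu (j + 1)) =
      facPow a u (lam (Fin.last n)) *
        ∏ i, stripWeight 1 (u + w) a u (lam i.castSucc) (lam i.succ) (nu i) := by
  obtain ⟨hint, hanti⟩ := mem_interlacing.mp hnu
  let F : ℕ → R := fun c => vertexWeight u w (a c)
    (partIndicator lam c - partIndicator nu c) (partIndicator nu c) (countGT lam c - countGT nu c)
  have h0 : ∏ j : Fin m, F (j + 1) = ∏ c ∈ Finset.Ico 1 (m + 1), F c := by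
    rw [Fin.prod_univ_eq_prod_range (fun j => F (j + 1)), Finset.range_eq_Ico,
      Finset.prod_Ico_add']
  change ∏ j : Fin m, F (j + 1) = _
  rw [h0, ← Finset.prod_Ico_consecutive F (show 1 ≤ lam 0 from (hm 0).1)
    ((hm 0).2.trans (Nat.le_succ m)), ← Finset.prod_Ico_consecutive F
    (show 1 ≤ lam (Fin.last n) from (hm _).1) (hlam.antitone (Fin.zero_le _)),
    prod_Ico_antitone F lam hlam.antitone]
  have htop : ∏ c ∈ Finset.Ico (lam 0) (m + 1), F c = 1 := by
    refine Finset.prod_eq_one fun c hc => ?_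
    rw [Finset.mem_Ico] at hc
    have h1 : countGT lam c = 0 := by
      have := lt_countGT hlam 0 c
      rw [Fin.val_zero] at this
      omega
    have h2 := ((interlacing_iff_countGT hlam hanti).mp hnu c).1
    have h3 : (countGT lam c : ℤ) - countGT nu c = 0 := by omega
    simp only [F, h3]
    refine vertexWeight_east_zero _ _ _ _ fun he => ?_
    by_cases hex : ∃ k, nu k = c
    · obtain ⟨k, rfl⟩ := hex
      have h4 := hlam.antitone (Fin.zero_le k.castSucc)
      have h5 := hint k
      rw [partIndicator_eq_one (lam := lam) 0 (by omega), partIndicator_eq_one k rfl] at he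
      omega
    · have := partIndicator_eq_zero (not_exists.mp hex)
      have := partIndicator_cases lam c
      omega
  have hbot : ∏ c ∈ Finset.Ico 1 (lam (Fin.last n)), F c = facPow a u (lam (Fin.last n)) := by
    refine Finset.prod_congr rfl fun c hc => ?_
    rw [Finset.mem_Ico] at hc
    have h1 : partIndicator lam c = 0 := partIndicator_eq_zero fun k => by
      have := hlam.antitone (Fin.le_last k)
      omega
    have h2 : partIndicator nu c = 0 := partIndicator_eq_zero fun k => by
      have := hlam.antitone (Fin.le_last k.succ)
      have := hint k
      omega
    have h3 : countGT lam c = n + 1 := by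
      have := lt_countGT hlam (Fin.last n) c
      rw [Fin.val_last] at this
      have := countGT_le lam c
      omega
    have h4 := (interlacing_iff_countGT hlam hanti).mp hnu c
    have h5 := countGT_le nu c
    have h6 : (countGT lam c : ℤ) - countGT nu c = 1 := by omega
    simp [F, h1, h2, h6, vertexWeight]
  rw [htop, hbot, mul_one]
  congr 1
  refine Finset.prod_congr rfl fun i _ => ?_
  obtain ⟨hi1, hi2⟩ := hint i
  have hlt : lam i.succ < lam i.castSucc := hlam Fin.castSucc_lt_succ
  have hcl : ∀ c, lam i.succ ≤ c → c < lam i.castSucc → countGT lam c = i + 1 := by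
    intro c h1 h2
    have h3 := lt_countGT hlam i.castSucc c
    have h4 := lt_countGT hlam i.succ c
    simp only [Fin.val_castSucc, Fin.val_succ] at h3 h4
    omega
  have hlow : ∏ c ∈ Finset.Ico (lam i.succ) (nu i), F c = 1 := by
    refine Finset.prod_eq_one fun c hc => ?_
    rw [Finset.mem_Ico] at hc
    have h1 := hcl c hc.1 (by omega)
    have h2 := (lt_countGT hanti i c).mpr hc.2
    have h3 := (interlacing_iff_countGT hlam hanti).mp hnu c
    have h4 : (countGT lam c : ℤ) - countGT nu c = 0 := by omega
    simp only [F, h4]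
    refine vertexWeight_east_zero _ _ _ _ fun he => ?_
    by_cases hex : ∃ k, nu k = c
    · obtain ⟨k, rfl⟩ := hex
      have h5 : i < k := hanti.lt_iff_gt.mp hc.2
      have h6 := hlam.antitone (show i.succ ≤ k.castSucc from Fin.succ_le_castSucc_iff.mpr h5)
      have h7 := hint k
      rw [partIndicator_eq_one (lam := lam) i.succ (by omega), partIndicator_eq_one k rfl] at he
      omega
    · have := partIndicator_eq_zero (not_exists.mp hex)
      have := partIndicator_cases lam c
      omega
  rw [← Finset.prod_Ico_consecutive F hi1 hi2, hlow, one_mul, stripWeight]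
  by_cases h1 : nu i = lam i.castSucc
  · simp [h1]
  · have hlt' : nu i < lam i.castSucc := lt_of_le_of_ne hi2 h1
    have heast : ∀ c, nu i ≤ c → c < lam i.castSucc → (countGT lam c : ℤ) - countGT nu c = 1 := by
      intro c h3 h4
      have h5 := hcl c (by omega) h4
      have h6 := lt_countGT hanti i c
      have h7 := (interlacing_iff_countGT hlam hanti).mp hnu c
      omega
    rw [if_neg h1, Finset.prod_eq_prod_Ico_succ_bot hlt']
    congr 1
    -- At column ν_i the vertex is NW with weight w - a if ν_i = λ_{i+1}, since the two indicators
    -- cancel, and NS with weight u + w otherwise.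
    · have h3 := heast (nu i) le_rfl hlt'
      have h4 := partIndicator_eq_one (lam := nu) i rfl
      by_cases h2 : nu i = lam i.succ
      · have h5 := partIndicator_eq_one (lam := lam) i.succ h2.symm
        simp only [F, h3, h4, h5, if_pos h2]
        simp [vertexWeight]
      · have h5 : partIndicator lam (nu i) = 0 := partIndicator_eq_zero fun k hk => by
          have h5 : i.castSucc < k := hlam.lt_iff_gt.mp (by omega)
          have h6 := hlam.antitone (Fin.castSucc_lt_iff_succ_le.mp h5)
          omega
        simp only [F, h3, h4, h5, if_neg h2]
        simp [vertexWeight]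
    · refine Finset.prod_congr rfl fun c hc => ?_
      rw [Finset.mem_Ico] at hc
      have h3 := heast c (by omega) hc.2
      have h4 : partIndicator lam c = 0 := partIndicator_eq_zero fun k hk => by
        have h5 : i.castSucc < k := hlam.lt_iff_gt.mp (by omega)
        have h6 := hlam.antitone (Fin.castSucc_lt_iff_succ_le.mp h5)
        omega
      have h5 : partIndicator nu c = 0 := partIndicator_eq_zero fun k hk => by
        have h6 : k < i := hanti.lt_iff_gt.mp (by omega)
        have h7 := hlam.antitone (show k.succ ≤ i.castSucc from Fin.succ_le_castSucc_iff.mpr h6)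
        have h8 := hint k
        omega
      simp [F, h3, h4, h5, vertexWeight]

end RowCombinatorics

/-! ### The row-by-row recursion for state matrices. -/

section StateMatrices

variable {n m : ℕ}

/-- The matrices whose partial column sums (from the top) and partial row sums (from the right)
are `0` or `1`, with row sums `1` and column sums the indicator of `lam`. -/
structure IsState (lam : Fin n → ℕ) (A : Matrix (Fin n) (Fin m) ℤ) : Prop where
  col : ∀ j t, prefixSum (fun i => A i j) t = 0 ∨ prefixSum (fun i => A i j) t = 1
  row : ∀ i t, suffixSum (A i) t = 0 ∨ suffixSum (A i) t = 1
  row_sum : ∀ i, ∑ j, A i j = 1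
  col_sum : ∀ j : Fin m, ∑ i, A i j = partIndicator lam (j + 1)

open Classical in
/-- The finite set of matrices satisfying `IsState lam`. -/
noncomputable def stateSet (m : ℕ) (lam : Fin n → ℕ) : Finset (Matrix (Fin n) (Fin m) ℤ) :=
  (Fintype.piFinset fun _ : Fin n => Fintype.piFinset fun _ : Fin m =>
    ({1, 0, -1} : Finset ℤ)).filter fun A => IsState lam A

theorem mem_piFinset_signs {A : Matrix (Fin n) (Fin m) ℤ} :
    (A ∈ Fintype.piFinset fun _ : Fin n => Fintype.piFinset fun _ : Fin m =>
      ({1, 0, -1} : Finset ℤ)) ↔ ∀ i j, A i j = 1 ∨ A i j = 0 ∨ A i j = -1 := by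
  refine Fintype.mem_piFinset.trans (forall_congr' fun i => Fintype.mem_piFinset.trans ?_)
  simp only [Finset.mem_insert, Finset.mem_singleton]

theorem mem_stateSet {lam : Fin n → ℕ} {A : Matrix (Fin n) (Fin m) ℤ} :
    A ∈ stateSet m lam ↔ IsState lam A := by
  classical
  refine Finset.mem_filter.trans (and_iff_right_iff_imp.mpr fun h => ?_)
  exact mem_piFinset_signs.mpr fun i j => ((alternates_iff_suffixSum (A i)).mpr (h.row i)).1 j

variable {R : Type*} [CommRing R]

/-- The product of the vertex weights of `A`. -/
def stateWeight (x y a : ℕ → R) (A : Matrix (Fin n) (Fin m) ℤ) : R :=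
  ∏ i : Fin n, ∏ j : Fin m, vertexWeight (x i) (y i) (a (j + 1)) (A i j)
    (prefixSum (fun i' => A i' j) i) (suffixSum (A i) (j + 1))

/-- Append a row at the bottom of a matrix. -/
def addRow (A : Matrix (Fin n) (Fin m) ℤ) (r : Fin m → ℤ) : Matrix (Fin (n + 1)) (Fin m) ℤ :=
  Fin.snoc (α := fun _ => Fin m → ℤ) A r

@[simp] theorem addRow_castSucc (A : Matrix (Fin n) (Fin m) ℤ) (r : Fin m → ℤ) (i : Fin n) :
    addRow A r i.castSucc = A i := Fin.snoc_castSucc ..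

@[simp] theorem addRow_last (A : Matrix (Fin n) (Fin m) ℤ) (r : Fin m → ℤ) :
    addRow A r (Fin.last n) = r := Fin.snoc_last ..

theorem addRow_init_last (B : Matrix (Fin (n + 1)) (Fin m) ℤ) :
    addRow (fun i => B i.castSucc) (B (Fin.last n)) = B := Fin.snoc_init_self B

theorem prefixSum_addRow (A : Matrix (Fin n) (Fin m) ℤ) (r : Fin m → ℤ) (j : Fin m) {t : ℕ}
    (ht : t ≤ n) : prefixSum (fun i => addRow A r i j) t = prefixSum (fun i => A i j) t := by
  rw [prefixSum, Fin.sum_univ_castSucc, if_neg (by rw [Fin.val_last]; omega), add_zero]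
  simp [prefixSum]

theorem sum_addRow (A : Matrix (Fin n) (Fin m) ℤ) (r : Fin m → ℤ) (j : Fin m) :
    ∑ i, addRow A r i j = ∑ i, A i j + r j := by
  simp [Fin.sum_univ_castSucc]

/-- The bottom row of a state matrix with column sums `lam` above which the column sums
are `nu`. -/
def bottomRow (m : ℕ) (lam : Fin (n + 1) → ℕ) (nu : Fin n → ℕ) (j : Fin m) : ℤ :=
  partIndicator lam (j + 1) - partIndicator nu (j + 1)

theorem bounds_of_interlacing {lam : Fin (n + 1) → ℕ} {nu : Fin n → ℕ}
    (hm : ∀ k, 0 < lam k ∧ lam k ≤ m) (hnu : nu ∈ interlacing lam) (k : Fin n) :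
    0 < nu k ∧ nu k ≤ m := by
  obtain ⟨h1, h2⟩ := (mem_interlacing.mp hnu).1 k
  exact ⟨(hm _).1.trans_le h1, h2.trans (hm _).2⟩

theorem suffixSum_bottomRow {lam : Fin (n + 1) → ℕ} (hlam : StrictAnti lam)
    (hm : ∀ k, 0 < lam k ∧ lam k ≤ m) {nu : Fin n → ℕ} (hanti : StrictAnti nu)
    (hm' : ∀ k, 0 < nu k ∧ nu k ≤ m) (t : ℕ) :
    suffixSum (bottomRow m lam nu) t = countGT lam t - countGT nu t := by
  rw [← suffixSum_partIndicator hlam hm, ← suffixSum_partIndicator hanti hm', ← suffixSum_sub]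
  rfl

theorem countGT_zero {lam : Fin n → ℕ} (h : ∀ k, 0 < lam k) : countGT lam 0 = n := by
  simp [countGT, h]

theorem eq_of_partIndicator_eq {lam nu : Fin n → ℕ} (hlam : StrictAnti lam) (hnu : StrictAnti nu)
    (hm : ∀ k, 0 < lam k ∧ lam k ≤ m) (hm' : ∀ k, 0 < nu k ∧ nu k ≤ m)
    (h : ∀ j : Fin m, partIndicator lam (j + 1) = partIndicator nu (j + 1)) : lam = nu := by
  have hc : ∀ t, countGT lam t = countGT nu t := fun t => by
    have h1 := suffixSum_partIndicator hlam hm t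
    rw [funext h, suffixSum_partIndicator hnu hm'] at h1
    exact_mod_cast h1.symm
  ext i
  have h1 := lt_countGT hlam i
  have h2 := lt_countGT hnu i
  simp only [hc] at h1
  have h3 : ∀ t, t < lam i ↔ t < nu i := fun t => (h1 t).symm.trans (h2 t)
  have h4 := h3 (lam i)
  have h5 := h3 (nu i)
  omega

theorem exists_partIndicator_eq (v : Fin m → ℤ) (hv : ∀ j, v j = 0 ∨ v j = 1)
    (hs : ∑ j, v j = n) :
    ∃ nu : Fin n → ℕ, StrictAnti nu ∧ (∀ k, 0 < nu k ∧ nu k ≤ m) ∧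
      ∀ j : Fin m, partIndicator nu (j + 1) = v j := by
  let s : Finset (Fin m) := Finset.univ.filter fun j => v j = 1
  have hcard : s.card = n := by
    have h1 : ∑ j, v j = ∑ j, if v j = 1 then 1 else 0 := Finset.sum_congr rfl fun j _ => by
      rcases hv j with h | h <;> simp [h]
    rw [h1, ← Finset.sum_filter, Finset.sum_const, nsmul_one] at hs
    exact_mod_cast hs
  let e := s.orderEmbOfFin hcard
  -- The enumeration `e` increases, so it is reversed; the added 1 passes from column index to
  -- column number.
  refine ⟨fun i => e i.rev + 1, fun i j hij => ?_, fun k => ⟨Nat.succ_pos _, (e k.rev).isLt⟩,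
    fun j => ?_⟩
  · have := e.strictMono (Fin.rev_lt_rev.mpr hij)
    exact Nat.succ_lt_succ this
  · have hr : j ∈ s ↔ ∃ i, e i = j := by
      rw [← Set.mem_range, Finset.range_orderEmbOfFin, Finset.mem_coe]
    have hj : j ∈ s ↔ v j = 1 := by simp [s]
    rcases hv j with h | h
    · rw [h]
      refine partIndicator_eq_zero fun k hk => ?_
      have := hj.mp (hr.mpr ⟨k.rev, Fin.ext (by simpa using hk)⟩)
      omega
    · rw [h]
      obtain ⟨i, hi⟩ := hr.mp (hj.mpr h)
      exact partIndicator_eq_one i.rev (by simp [hi])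

theorem IsState.addRow {lam : Fin (n + 1) → ℕ} (hlam : StrictAnti lam)
    (hm : ∀ k, 0 < lam k ∧ lam k ≤ m) {nu : Fin n → ℕ} (hnu : nu ∈ interlacing lam)
    {A : Matrix (Fin n) (Fin m) ℤ} (hA : IsState nu A) :
    IsState lam (addRow A (bottomRow m lam nu)) := by
  have hanti := (mem_interlacing.mp hnu).2
  have hm' := bounds_of_interlacing hm hnu
  have hcs : ∀ j : Fin m,
      ∑ i, _root_.addRow A (bottomRow m lam nu) i j = partIndicator lam (j + 1) := fun j => by
    rw [sum_addRow, hA.col_sum, bottomRow]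
    ring
  refine ⟨fun j t => ?_, fun i t => ?_, fun i => ?_, hcs⟩
  · rcases Nat.lt_or_ge n t with ht | ht
    · rw [prefixSum_of_le _ ht, hcs]
      exact partIndicator_cases _ _
    · rw [prefixSum_addRow _ _ _ ht]
      exact hA.col j t
  · refine Fin.lastCases ?_ (fun i => ?_) i
    · rw [addRow_last, suffixSum_bottomRow hlam hm hanti hm']
      have := (interlacing_iff_countGT hlam hanti).mp hnu t
      omega
    · rw [addRow_castSucc]
      exact hA.row i t
  · refine Fin.lastCases ?_ (fun i => ?_) i
    · rw [addRow_last, ← suffixSum_zero, suffixSum_bottomRow hlam hm hanti hm',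
        countGT_zero fun k => (hm k).1, countGT_zero fun k => (hm' k).1]
      push_cast
      ring
    · rw [addRow_castSucc]
      exact hA.row_sum i

/-- The column sums of the first n rows are 0 or 1 and total n because each row sums to 1, so they
are the indicator of a strict partition ν of length n. -/
theorem IsState.exists_of_addRow {lam : Fin (n + 1) → ℕ} (hlam : StrictAnti lam)
    (hm : ∀ k, 0 < lam k ∧ lam k ≤ m) {A : Matrix (Fin n) (Fin m) ℤ} {r : Fin m → ℤ}
    (hA : IsState lam (_root_.addRow A r)) :
    ∃ nu ∈ interlacing lam, IsState nu A ∧ r = bottomRow m lam nu := by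
  have hcol : ∀ j t, prefixSum (fun i => A i j) t = 0 ∨ prefixSum (fun i => A i j) t = 1 := by
    intro j t
    have h1 : ∀ t ≤ n, prefixSum (fun i => A i j) t = 0 ∨ prefixSum (fun i => A i j) t = 1 :=
      fun t ht => by
        rw [← prefixSum_addRow A r j ht]
        exact hA.col j t
    rcases le_total t n with ht | ht
    · exact h1 t ht
    · rw [prefixSum_of_le _ ht, ← prefixSum_of_le _ le_rfl]
      exact h1 n le_rfl
  have hrs : ∀ i, ∑ j, A i j = 1 := fun i => by
    have := hA.row_sum i.castSucc
    rwa [addRow_castSucc] at this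
  obtain ⟨nu, hanti, hm', hind⟩ := exists_partIndicator_eq (n := n) (fun j => ∑ i, A i j)
    (fun j => by
      have := hcol j n
      rwa [prefixSum_of_le _ le_rfl] at this)
    (by rw [Finset.sum_comm]; simp [hrs])
  have hr : r = bottomRow m lam nu := by
    ext j
    have := hA.col_sum j
    rw [sum_addRow] at this
    rw [bottomRow, hind, ← this]
    ring
  refine ⟨nu, (interlacing_iff_countGT hlam hanti).mpr fun t => ?_, ⟨hcol, fun i t => ?_, hrs,
    fun j => (hind j).symm⟩, hr⟩
  · have := hA.row (Fin.last n) t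
    rw [addRow_last, hr, suffixSum_bottomRow hlam hm hanti hm'] at this
    omega
  · have := hA.row i.castSucc t
    rwa [addRow_castSucc] at this

/-- Vertex weights look only north and east, so a new bottom row leaves the weights above it
unchanged. -/
theorem stateWeight_addRow (x y a : ℕ → R) {lam : Fin (n + 1) → ℕ} (hlam : StrictAnti lam)
    (hm : ∀ k, 0 < lam k ∧ lam k ≤ m) {nu : Fin n → ℕ} (hnu : nu ∈ interlacing lam)
    {A : Matrix (Fin n) (Fin m) ℤ} (hA : IsState nu A) :
    stateWeight x y a (addRow A (bottomRow m lam nu)) =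
      stateWeight x y a A * (facPow a (x n) (lam (Fin.last n)) *
        ∏ i, stripWeight 1 (x n + y n) a (x n) (lam i.castSucc) (lam i.succ) (nu i)) := by
  rw [stateWeight, Fin.prod_univ_castSucc]
  congr 1
  · refine Finset.prod_congr rfl fun i _ => Finset.prod_congr rfl fun j _ => ?_
    rw [addRow_castSucc, Fin.val_castSucc, prefixSum_addRow _ _ _ i.isLt.le]
  · rw [← prod_vertexWeight hlam hm hnu]
    refine Finset.prod_congr rfl fun j _ => ?_
    rw [addRow_last, Fin.val_last, prefixSum_addRow _ _ _ le_rfl, prefixSum_of_le _ le_rfl,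
      hA.col_sum, suffixSum_bottomRow hlam hm (mem_interlacing.mp hnu).2
        (bounds_of_interlacing hm hnu)]
    rfl

theorem sum_stateWeight_succ (x y a : ℕ → R) {lam : Fin (n + 1) → ℕ} (hlam : StrictAnti lam)
    (hm : ∀ k, 0 < lam k ∧ lam k ≤ m) :
    ∑ A ∈ stateSet m lam, stateWeight x y a A =
      facPow a (x n) (lam (Fin.last n)) * ∑ nu ∈ interlacing lam,
        (∏ i, stripWeight 1 (x n + y n) a (x n) (lam i.castSucc) (lam i.succ) (nu i)) *
          ∑ A ∈ stateSet m nu, stateWeight x y a A := by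
  simp only [Finset.mul_sum]
  rw [Finset.sum_sigma']
  symm
  refine Finset.sum_bij (fun p _ => addRow p.2 (bottomRow m lam p.1)) ?_ ?_ ?_ ?_
  · rintro ⟨nu, A⟩ h
    rw [Finset.mem_sigma, mem_stateSet] at h
    exact mem_stateSet.mpr (IsState.addRow hlam hm h.1 h.2)
  · rintro ⟨nu, A⟩ h ⟨nu', A'⟩ h' he
    rw [Finset.mem_sigma, mem_stateSet] at h h'
    have hA : A = A' := by
      ext i j
      have := congrFun (congrFun he i.castSucc) j
      simpa using this
    subst hA
    -- The column sums of the upper block determine ν.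
    have : nu = nu' := eq_of_partIndicator_eq (mem_interlacing.mp h.1).2
      (mem_interlacing.mp h'.1).2 (bounds_of_interlacing hm h.1) (bounds_of_interlacing hm h'.1)
      fun j => (h.2.col_sum j).symm.trans (h'.2.col_sum j)
    rw [this]
  · intro B hB
    rw [mem_stateSet, ← addRow_init_last B] at hB
    obtain ⟨nu, hnu, hA, hr⟩ := hB.exists_of_addRow hlam hm
    refine ⟨⟨nu, fun i => B i.castSucc⟩, Finset.mem_sigma.mpr ⟨hnu, mem_stateSet.mpr hA⟩, ?_⟩
    simp only [← hr, addRow_init_last]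
  · rintro ⟨nu, A⟩ h
    rw [Finset.mem_sigma, mem_stateSet] at h
    simp only [stateWeight_addRow x y a hlam hm h.1 h.2]
    ring

/-- The number m of columns is kept independent of λ: removing a row may lower the largest part but
never removes columns. -/
theorem sum_stateWeight (x y a : ℕ → R) (m : ℕ) :
    ∀ {n : ℕ} {lam : Fin n → ℕ}, StrictAnti lam → (∀ k, 0 < lam k ∧ lam k ≤ m) →
      ∑ A ∈ stateSet m lam, stateWeight x y a A =
        (∏ j ∈ Finset.range n, ∏ i ∈ Finset.range j, (x i + y j)) *
          (divDiffMatrix a x n lam).det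
  | 0, lam, _, _ => by
    have : stateSet m lam = {0} := Finset.eq_singleton_iff_unique_mem.mpr
      ⟨mem_stateSet.mpr ⟨fun j t => by simp [prefixSum], fun i => i.elim0, fun i => i.elim0,
        fun j => by simp [partIndicator]⟩, fun A _ => Subsingleton.elim _ _⟩
    simp [this, stateWeight]
  | n + 1, lam, hlam, hm => by
    rw [sum_stateWeight_succ x y a hlam hm, Finset.prod_range_succ, mul_assoc,
      ← Fin.prod_univ_eq_prod_range (fun i => x i + y n) n,
      prod_mul_det_divDiffMatrix_succ a x (y n) n lam hlam fun k => (hm k).1]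
    rw [mul_left_comm, Finset.mul_sum _ _ (∏ j ∈ _, _)]
    congr 1
    refine Finset.sum_congr rfl fun nu hnu => ?_
    rw [sum_stateWeight x y a m (mem_interlacing.mp hnu).2 (bounds_of_interlacing hm hnu)]
    ring

end StateMatrices

/-! ### Compass points as partial sums. -/

section CompassPoints

variable {n m : ℕ}

theorem northIsOne_iff {lam : Fin n → ℕ} {A : Matrix (Fin n) (Fin m) ℤ} (hA : IsState lam A)
    (i : Fin n) (j : Fin m) : NorthIsOne A i j ↔ prefixSum (fun i' => A i' j) i = 1 :=
  lastNonzeroIs_one_iff (hA.col j) i.isLt.le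

theorem eastIsOne_iff {lam : Fin n → ℕ} {A : Matrix (Fin n) (Fin m) ℤ} (hA : IsState lam A)
    (i : Fin n) (j : Fin m) : EastIsOne A i j ↔ suffixSum (A i) (j + 1) = 1 := by
  rw [suffixSum_eq_prefixSum_rev, ← lastNonzeroIs_one_iff (fun t => by
    rw [prefixSum_rev_eq_suffixSum]
    exact hA.row i _) (Nat.sub_le _ _)]
  have hlt : ∀ q : Fin m, (q.rev : ℕ) < m - (j + 1) ↔ j < q := fun q => by
    rw [Fin.val_rev, Fin.lt_def]
    omega
  refine Iff.trans (exists_congr fun q => ?_) Fin.rev_surjective.exists.symm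
  rw [hlt, Fin.rev_surjective.forall]
  simp only [Function.comp_apply, Fin.rev_rev]
  refine and_congr Iff.rfl (and_congr Iff.rfl (forall_congr' fun r => ?_))
  have hr := hlt r.rev
  rw [Fin.rev_rev] at hr
  rw [hr, Fin.rev_lt_iff]
  exact ⟨fun h h1 h2 => h h2 h1, fun h h1 h2 => h h2 h1⟩

theorem asmWeight_eq {R : Type*} [CommRing R] (x y a : ℕ → R) {lam : Fin n → ℕ}
    {A : Matrix (Fin n) (Fin m) ℤ} (hA : IsState lam A) :
    asmWeight (fun i : Fin n => x i) (fun i => y i) a A =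
      (∏ i : Fin n, x i) * stateWeight x y a A := by
  rw [asmWeight, stateWeight]
  congr 1
  refine Finset.prod_congr rfl fun i _ => Finset.prod_congr rfl fun j _ => ?_
  rw [cpm, vertexWeight]
  simp only [northIsOne_iff hA, eastIsOne_iff hA]
  split_ifs <;> rfl

theorem isState_of_isASM [NeZero n] {lam : StrictPartition n}
    {A : Matrix (Fin n) (Fin (lam.parts 0)) ℤ} (he : ∀ i j, A i j = 1 ∨ A i j = 0 ∨ A i j = -1) :
    IsASM lam A ↔ IsState lam.parts A := by
  constructor
  · intro h
    refine ⟨fun j => (alternates_iff_prefixSum _).mp ⟨fun i => he i j, h.alternates_col j,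
      fun i => h.topmost i j⟩, fun i => (alternates_iff_suffixSum _).mp ⟨he i, h.alternates_row i,
      fun j => h.rightmost i j⟩, h.row_sum, fun j => ?_⟩
    rw [partIndicator]
    split_ifs with hj
    · exact h.col_sum_part j hj
    · exact h.col_sum_nonpart j hj
  · intro h
    have hr := fun i => (alternates_iff_suffixSum _).mpr (h.row i)
    have hc := fun j => (alternates_iff_prefixSum _).mpr (h.col j)
    exact ⟨fun i => (hr i).2.1, fun j => (hc j).2.1, fun i j => (hr i).2.2 j,
      fun i j => (hc j).2.2 i, h.row_sum, fun j hj => (h.col_sum j).trans (if_pos hj),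
      fun j hj => (h.col_sum j).trans (if_neg hj)⟩

theorem asmSet_eq_stateSet [NeZero n] (lam : StrictPartition n) :
    asmSet lam = stateSet (lam.parts 0) lam.parts := by
  classical
  ext A
  exact Finset.mem_filter.trans ((and_congr_right fun hA =>
    isState_of_isASM (mem_piFinset_signs.mp hA)).trans Finset.mem_filter.symm)

end CompassPoints

/-! ### The branching of tableaux by their largest letter. -/

section Tableaux

variable {μ κ : YoungDiagram} {n : ℕ}

/-- The boxes of a tableau with entries less than `n`. -/
def SemistandardYoungTableau.below (T : SemistandardYoungTableau μ) (n : ℕ) : YoungDiagram where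
  cells := μ.cells.filter fun c => T c.1 c.2 < n
  isLowerSet := by
    rintro ⟨i, j⟩ ⟨i', j'⟩ hle h
    obtain ⟨hi, hj⟩ := Prod.mk_le_mk.mp hle
    simp only [Finset.coe_filter, Set.mem_ofPred_eq, YoungDiagram.mem_cells] at h ⊢
    refine ⟨μ.up_left_mem hi hj h.1, lt_of_le_of_lt ?_ h.2⟩
    exact (T.row_weak_of_le hj (μ.up_left_mem hi le_rfl h.1)).trans (T.col_weak hi h.1)

theorem SemistandardYoungTableau.mem_below {T : SemistandardYoungTableau μ} {i j : ℕ} :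
    (i, j) ∈ T.below n ↔ (i, j) ∈ μ ∧ T i j < n := by
  rw [← YoungDiagram.mem_cells, below, Finset.mem_filter, YoungDiagram.mem_cells]

/-- The entries of `T` lying in the boxes of `κ`. -/
def restrictTableau (T : SemistandardYoungTableau μ) (h : κ ≤ μ) : SemistandardYoungTableau κ where
  entry i j := if (i, j) ∈ κ then T i j else 0
  row_weak' {i j1 j2} hj hm := by
    rw [if_pos hm, if_pos (κ.up_left_mem le_rfl hj.le hm)]
    exact T.row_weak hj (h hm)
  col_strict' {i1 i2 j} hi hm := by
    rw [if_pos hm, if_pos (κ.up_left_mem hi.le le_rfl hm)]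
    exact T.col_strict hi (h hm)
  zeros' {i j} hm := if_neg hm

theorem restrictTableau_apply (T : SemistandardYoungTableau μ) (h : κ ≤ μ) {i j : ℕ}
    (hm : (i, j) ∈ κ) : restrictTableau T h i j = T i j := if_pos hm

/-- Extend a tableau with entries less than `n` by entries `n` along a horizontal strip. -/
def extendTableau (T : BoundedSSYT κ n) (h : κ ≤ μ) (hs : ∀ i j, (i + 1, j) ∈ μ → (i, j) ∈ κ) :
    SemistandardYoungTableau μ where
  entry i j := if (i, j) ∈ κ then T.1 i j else if (i, j) ∈ μ then n else 0
  row_weak' {i j1 j2} hj hm := by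
    by_cases h2 : (i, j2) ∈ κ
    · rw [if_pos h2, if_pos (κ.up_left_mem le_rfl hj.le h2)]
      exact T.1.row_weak hj h2
    · rw [if_neg h2, if_pos hm, if_pos (μ.up_left_mem le_rfl hj.le hm)]
      split_ifs with h1
      · exact (T.2 _ _ h1).le
      · exact le_rfl
  col_strict' {i1 i2 j} hi hm := by
    have h1 := hs i1 j (μ.up_left_mem hi le_rfl hm)
    rw [if_pos h1]
    split_ifs with h2
    · exact T.1.col_strict hi h2
    · exact T.2 _ _ h1
  zeros' {i j} hm := by rw [if_neg fun hk => hm (h hk), if_neg hm]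

section

variable (T : BoundedSSYT κ n) (h : κ ≤ μ) (hs : ∀ i j, (i + 1, j) ∈ μ → (i, j) ∈ κ)

theorem extendTableau_apply_of_mem {i j : ℕ} (hm : (i, j) ∈ κ) :
    extendTableau T h hs i j = T.1 i j := if_pos hm

theorem extendTableau_apply_of_notMem {i j : ℕ} (hm : (i, j) ∈ μ) (hk : (i, j) ∉ κ) :
    extendTableau T h hs i j = n := (if_neg hk).trans (if_pos hm)

theorem extendTableau_lt {i j : ℕ} (hm : (i, j) ∈ μ) : extendTableau T h hs i j < n + 1 := by
  by_cases hk : (i, j) ∈ κ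
  · rw [extendTableau_apply_of_mem T h hs hk]
    exact (T.2 _ _ hk).trans (Nat.lt_succ_self n)
  · rw [extendTableau_apply_of_notMem T h hs hm hk]
    exact Nat.lt_succ_self n

theorem below_extendTableau : (extendTableau T h hs).below n = κ := by
  ext ⟨i, j⟩
  rw [YoungDiagram.mem_cells, YoungDiagram.mem_cells, SemistandardYoungTableau.mem_below]
  by_cases hk : (i, j) ∈ κ
  · simp only [extendTableau_apply_of_mem T h hs hk, h hk, T.2 _ _ hk, hk, and_self]
  · refine iff_of_false (fun hm => ?_) hk
    have := hm.2
    rw [extendTableau_apply_of_notMem T h hs hm.1 hk] at this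
    exact lt_irrefl _ this

end

variable {R : Type*} [CommRing R]

theorem factorialSchur_eq_sum_prod_cells (x a : ℕ → R) :
    factorialSchur μ (fun i : Fin n => x i) a =
      ∑ T : BoundedSSYT μ n, ∏ c ∈ μ.cells,
        (x (T.1 c.1 c.2) + a (T.1 c.1 c.2 + 1 + c.2 - c.1)) := by
  refine Finset.sum_congr rfl fun T _ => ?_
  exact Finset.prod_coe_sort μ.cells
    fun c => x (T.1 c.1 c.2) + a (T.1 c.1 c.2 + 1 + c.2 - c.1)

open Classical in
-- A tableau with prescribed κ is a tableau of shape κ in the smaller letters, with n in every other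
-- box; `hs` says that those boxes form a horizontal strip.
theorem sum_below_eq (x a : ℕ → R) (h : κ ≤ μ) (hs : ∀ i j, (i + 1, j) ∈ μ → (i, j) ∈ κ) :
    ∑ T : BoundedSSYT μ (n + 1) with T.1.below n = κ,
        ∏ c ∈ μ.cells, (x (T.1 c.1 c.2) + a (T.1 c.1 c.2 + 1 + c.2 - c.1)) =
      (∏ c ∈ μ.cells \ κ.cells, (x n + a (n + 1 + c.2 - c.1))) *
        factorialSchur κ (fun i : Fin n => x i) a := by
  have hb : ∀ T : BoundedSSYT μ (n + 1), T.1.below n = κ → ∀ i j, (i, j) ∈ κ → T.1 i j < n := by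
    rintro T rfl i j hm
    exact (SemistandardYoungTableau.mem_below.mp hm).2
  have hn : ∀ T : BoundedSSYT μ (n + 1), T.1.below n = κ → ∀ i j, (i, j) ∈ μ → (i, j) ∉ κ →
      T.1 i j = n := by
    rintro T rfl i j hm hk
    have h1 := T.2 i j hm
    have h2 : ¬ T.1 i j < n := fun h2 => hk (SemistandardYoungTableau.mem_below.mpr ⟨hm, h2⟩)
    omega
  rw [factorialSchur_eq_sum_prod_cells, Finset.mul_sum]
  refine Finset.sum_bij'
    (fun T hT => ⟨restrictTableau T.1 h, fun i j hm => by
      rw [restrictTableau_apply _ _ hm]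
      exact hb T (Finset.mem_filter.mp hT).2 i j hm⟩)
    (fun T _ => ⟨extendTableau T h hs, fun i j hm => extendTableau_lt T h hs hm⟩)
    (fun _ _ => Finset.mem_univ _)
    (fun T _ => Finset.mem_filter.mpr ⟨Finset.mem_univ _, below_extendTableau T h hs⟩)
    (fun T hT => ?_) (fun T _ => ?_) (fun T hT => ?_)
  · refine Subtype.ext (SemistandardYoungTableau.ext fun i j => ?_)
    by_cases hk : (i, j) ∈ κ
    · simp only [extendTableau_apply_of_mem _ h hs hk, restrictTableau_apply _ h hk]
    · by_cases hm : (i, j) ∈ μ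
      · simp only [extendTableau_apply_of_notMem _ h hs hm hk,
          hn T (Finset.mem_filter.mp hT).2 i j hm hk]
      · rw [SemistandardYoungTableau.zeros _ hm, SemistandardYoungTableau.zeros _ hm]
  · refine Subtype.ext (SemistandardYoungTableau.ext fun i j => ?_)
    by_cases hk : (i, j) ∈ κ
    · simp only [restrictTableau_apply _ h hk, extendTableau_apply_of_mem _ h hs hk]
    · rw [SemistandardYoungTableau.zeros _ hk, SemistandardYoungTableau.zeros _ hk]
  · have hT' := (Finset.mem_filter.mp hT).2
    rw [← Finset.prod_sdiff (show κ.cells ⊆ μ.cells from h)]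
    congr 1
    · refine Finset.prod_congr rfl fun c hc => ?_
      rw [Finset.mem_sdiff, YoungDiagram.mem_cells, YoungDiagram.mem_cells] at hc
      rw [hn T hT' c.1 c.2 hc.1 hc.2]
    · refine Finset.prod_congr rfl fun c hc => ?_
      rw [YoungDiagram.mem_cells] at hc
      simp only [restrictTableau_apply T.1 h (i := c.1) (j := c.2) hc]

theorem rowLen_mono (h : κ ≤ μ) (i : ℕ) : κ.rowLen i ≤ μ.rowLen i := by
  by_contra hc
  have := YoungDiagram.mem_iff_lt_rowLen.mp (h (YoungDiagram.mem_iff_lt_rowLen.mpr (not_le.mp hc)))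
  exact lt_irrefl _ this

/-- The strict partition `κ + δ`, where `κ` is the shape of the entries of `T` less than `n`. -/
def shapeBelow (T : SemistandardYoungTableau μ) (n : ℕ) (i : Fin n) : ℕ :=
  (T.below n).rowLen i + (n - i)

theorem shapeBelow_strictAnti (T : SemistandardYoungTableau μ) : StrictAnti (shapeBelow T n) := by
  intro i j hij
  have := (T.below n).rowLen_anti i j hij.le
  have := i.isLt
  rw [Fin.lt_def] at hij
  unfold shapeBelow
  omega

/-- An entry in row i is at least i, so entries below n occupy only the first n rows and
`shapeBelow` loses nothing. -/
theorem shapeBelow_eq_iff (T : SemistandardYoungTableau μ) (nu : StrictPartition n) :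
    shapeBelow T n = nu.parts ↔ T.below n = nu.subDelta := by
  constructor
  · intro h
    ext ⟨i, j⟩
    rw [YoungDiagram.mem_cells, YoungDiagram.mem_cells, StrictPartition.mem_subDelta, ← h]
    constructor
    · intro hm
      have h1 := SemistandardYoungTableau.mem_below.mp hm
      have h2 := row_le_entry T i j h1.1
      refine ⟨h2.trans_lt h1.2, ?_⟩
      have := YoungDiagram.mem_iff_lt_rowLen.mp hm
      simp only [shapeBelow]
      omega
    · rintro ⟨h1, h2⟩
      simp only [shapeBelow] at h2
      exact YoungDiagram.mem_iff_lt_rowLen.mpr (by omega)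
  · intro h
    ext i
    rw [shapeBelow, h, nu.parts_eq]

/-- The upper bound is strict because the staircase of λ is one longer in each row. The lower bound
is column strictness: a box lying above another box of the diagram cannot hold the largest letter.
-/
theorem shapeBelow_mem {lam : StrictPartition (n + 1)} (T : BoundedSSYT lam.subDelta (n + 1)) :
    shapeBelow T.1 n ∈ interlacing lam.parts ∧
      ∀ i, shapeBelow T.1 n i < lam.parts i.castSucc := by
  have hlt : ∀ i, shapeBelow T.1 n i < lam.parts i.castSucc := fun i => by
    have := rowLen_mono (fun c hc => (SemistandardYoungTableau.mem_below.mp hc).1 :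
      T.1.below n ≤ lam.subDelta) i
    rw [lam.parts_eq, shapeBelow, Fin.val_castSucc]
    omega
  refine ⟨mem_interlacing.mpr ⟨fun i => ⟨?_, (hlt i).le⟩, shapeBelow_strictAnti T.1⟩, hlt⟩
  rw [lam.parts_eq, shapeBelow, Fin.val_succ, Nat.add_sub_add_right]
  refine Nat.add_le_add_right ?_ _
  by_contra hc
  have h1 : ((i : ℕ) + 1, (T.1.below n).rowLen i) ∈ lam.subDelta :=
    YoungDiagram.mem_iff_lt_rowLen.mpr (not_le.mp hc)
  have h2 : T.1 i _ < T.1 (i + 1) _ := T.1.col_strict (Nat.lt_succ_self i) h1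
  have h3 := T.2 _ _ h1
  have h4 := YoungDiagram.mem_iff_lt_rowLen.mp (SemistandardYoungTableau.mem_below.mpr
    ⟨lam.subDelta.up_left_mem (Nat.le_succ i) le_rfl h1, show T.1 i _ < n by omega⟩)
  exact lt_irrefl _ h4

/-- Shifting row i by n + 1 - i makes the column position equal to the index of a, so the strip in
row i carries the indices from ν_i + 1 to λ_i - 1. -/
theorem prod_sdiff_subDelta (lam : StrictPartition (n + 1)) (nu : StrictPartition n)
    (hnu : nu.parts ∈ interlacing lam.parts) (hlt : ∀ i, nu.parts i < lam.parts i.castSucc)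
    (u : R) (a : ℕ → R) :
    ∏ c ∈ lam.subDelta.cells \ nu.subDelta.cells, (u + a (n + 1 + c.2 - c.1)) =
      facPow a u (lam.parts (Fin.last n)) *
        ∏ i, stripWeight 0 1 a u (lam.parts i.castSucc) (lam.parts i.succ) (nu.parts i) := by
  -- The padding 0 makes the strip of the last row start at index 1, which gives the factorial
  -- power.
  let nu' : Fin (n + 1) → ℕ := Fin.snoc (α := fun _ => ℕ) nu.parts 0
  have hnu' : ∀ i : Fin (n + 1), n - i ≤ nu' i := by
    refine Fin.lastCases (by simp) fun i => ?_
    simpa [nu'] using nu.delta_le i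
  have hcells : lam.subDelta.cells \ nu.subDelta.cells =
      (Finset.univ : Finset (Fin (n + 1))).biUnion fun i =>
        (Finset.Ico (nu' i + 1) (lam.parts i)).image fun c => ((i : ℕ), c - (n + 1 - i)) := by
    ext ⟨i, j⟩
    rw [Finset.mem_sdiff, YoungDiagram.mem_cells, YoungDiagram.mem_cells,
      StrictPartition.mem_subDelta, StrictPartition.mem_subDelta]
    simp only [Finset.mem_biUnion, Finset.mem_univ, true_and, Finset.mem_image, Finset.mem_Ico,
      Prod.mk.injEq]
    constructor
    · rintro ⟨⟨hi, hj⟩, hk⟩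
      refine ⟨⟨i, hi⟩, j + (n + 1 - i), ⟨?_, hj⟩, rfl, by simp⟩
      rcases Nat.lt_succ_iff_lt_or_eq.mp hi with h | h
      · have : nu' ⟨i, hi⟩ = nu.parts ⟨i, h⟩ := Fin.snoc_castSucc (α := fun _ => ℕ) _ _ ⟨i, h⟩
        rw [this]
        by_contra hc
        exact hk ⟨h, by omega⟩
      · have : nu' ⟨i, hi⟩ = 0 := by
          subst h
          exact Fin.snoc_last (α := fun _ => ℕ) _ _
        omega
    · rintro ⟨k, c, ⟨h1, h2⟩, rfl, rfl⟩
      have h3 := hnu' k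
      have h4 := k.isLt
      refine ⟨⟨h4, by simp only [Fin.eta]; omega⟩, ?_⟩
      rintro ⟨h5, h6⟩
      have : nu' k = nu.parts ⟨k, h5⟩ := Fin.snoc_castSucc (α := fun _ => ℕ) _ _ ⟨k, h5⟩
      omega
  have hrow : ∀ i : Fin (n + 1), ∏ c ∈ (Finset.Ico (nu' i + 1) (lam.parts i)).image
      (fun c => ((i : ℕ), c - (n + 1 - i))), (u + a (n + 1 + c.2 - c.1)) =
        ∏ c ∈ Finset.Ico (nu' i + 1) (lam.parts i), (u + a c) := by
    intro i
    have h3 := hnu' i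
    have h4 := i.isLt
    rw [Finset.prod_image]
    · refine Finset.prod_congr rfl fun c hc => ?_
      rw [Finset.mem_Ico] at hc
      congr 2
      simp only
      omega
    · intro c hc d hd hcd
      simp only [Finset.coe_Ico, Set.mem_Ico, Prod.mk.injEq, true_and] at hc hd hcd
      omega
  rw [hcells, Finset.prod_biUnion, Finset.prod_congr rfl fun i _ => hrow i, Fin.prod_univ_castSucc,
    mul_comm]
  · congr 1
    · simp [nu', facPow]
    · refine Finset.prod_congr rfl fun i _ => ?_
      simp [nu', stripWeight, (hlt i).ne]
  · intro i _ k _ hik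
    refine Finset.disjoint_left.mpr fun c hc hd => hik ?_
    simp only [Finset.mem_image] at hc hd
    obtain ⟨c', -, rfl⟩ := hc
    obtain ⟨d', -, hd⟩ := hd
    exact Fin.ext (Prod.mk.inj hd).1.symm

theorem factorialSchur_eq_det (x a : ℕ → R) :
    ∀ {n : ℕ} (lam : StrictPartition n),
      factorialSchur lam.subDelta (fun i : Fin n => x i) a = (divDiffMatrix a x n lam.parts).det
  | 0, lam => by
    have hμ : ∀ i j, (i, j) ∉ lam.subDelta := fun i j h => by
      rw [StrictPartition.mem_subDelta] at h
      exact absurd h.1 (Nat.not_lt_zero _)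
    have hc : lam.subDelta.cells = ∅ := Finset.eq_empty_of_forall_notMem fun c hc => hμ c.1 c.2 hc
    have : Unique (BoundedSSYT lam.subDelta 0) :=
      { default := ⟨SemistandardYoungTableau.highestWeight _, fun i j h => absurd h (hμ i j)⟩
        uniq := fun T => Subtype.ext (SemistandardYoungTableau.ext fun i j => by
          rw [SemistandardYoungTableau.zeros _ (hμ i j), SemistandardYoungTableau.zeros _ (hμ i j)]) }
    rw [factorialSchur_eq_sum_prod_cells]
    simp [hc]
  | n + 1, lam => by
    classical
    rw [det_divDiffMatrix_succ a x n lam.parts lam.strictAnti lam.pos,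
      factorialSchur_eq_sum_prod_cells, Finset.mul_sum]
    have hmaps : ∀ T ∈ (Finset.univ : Finset (BoundedSSYT lam.subDelta (n + 1))),
        shapeBelow T.1 n ∈ interlacing lam.parts := fun T _ => (shapeBelow_mem T).1
    refine (Finset.sum_fiberwise_of_maps_to hmaps _).symm.trans ?_
    refine Finset.sum_congr rfl fun nu hnu => ?_
    have hmem := mem_interlacing.mp hnu
    let nu' : StrictPartition n := ⟨nu, hmem.2, fun i => (lam.pos _).trans_le (hmem.1 i).1⟩
    by_cases hlt : ∀ i, nu i < lam.parts i.castSucc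
    · have hle : nu'.subDelta ≤ lam.subDelta := by
        rintro ⟨i, j⟩ h
        rw [StrictPartition.mem_subDelta] at h ⊢
        obtain ⟨h1, h2⟩ := h
        have h3 : nu'.parts ⟨i, h1⟩ < lam.parts ⟨i, _⟩ := hlt ⟨i, h1⟩
        exact ⟨by omega, by omega⟩
      have hs : ∀ i j, (i + 1, j) ∈ lam.subDelta → (i, j) ∈ nu'.subDelta := by
        intro i j h
        rw [StrictPartition.mem_subDelta] at h ⊢
        obtain ⟨h1, h2⟩ := h
        have h3 : lam.parts ⟨i + 1, h1⟩ ≤ nu'.parts ⟨i, _⟩ := (hmem.1 ⟨i, by omega⟩).1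
        exact ⟨by omega, by omega⟩
      have h := sum_below_eq (n := n) x a hle hs
      rw [prod_sdiff_subDelta lam nu' hnu hlt, factorialSchur_eq_det x a nu', mul_assoc] at h
      rw [← h]
      refine Finset.sum_congr ?_ fun _ _ => rfl
      exact Finset.filter_congr fun T _ => shapeBelow_eq_iff T.1 nu'
    -- If ν_i = λ_i for some i, no tableau yields ν, and its strip weight contains the factor α = 0.
    · obtain ⟨i, hi⟩ := not_forall.mp hlt
      rw [Finset.filter_eq_empty_iff.mpr, Finset.sum_empty, Finset.prod_eq_zero (Finset.mem_univ i),
        zero_mul, mul_zero]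
      · rw [stripWeight, if_pos (le_antisymm (hmem.1 i).2 (not_lt.mp hi))]
      · rintro T - rfl
        exact hi ((shapeBelow_mem T).2 i)

end Tableaux

/-! ### The product over pairs and the conclusion. -/

theorem prod_filter_lt_eq_prod_range {R : Type*} [CommMonoid R] (n : ℕ) (f : ℕ → ℕ → R) :
    (∏ p : Fin n × Fin n with p.1 < p.2, f p.1 p.2) =
      ∏ j ∈ Finset.range n, ∏ i ∈ Finset.range j, f i j := by
  rw [Finset.prod_filter, ← Finset.univ_product_univ, Finset.prod_product_right,
    ← Fin.prod_univ_eq_prod_range (fun j => ∏ i ∈ Finset.range j, f i j)]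
  refine Finset.prod_congr rfl fun j _ => ?_
  simp only [Fin.lt_def]
  rw [Fin.prod_univ_eq_prod_range (fun i => if i < (j : ℕ) then f i j else 1),
    ← Finset.prod_filter]
  refine Finset.prod_congr (Finset.ext fun i => ?_) fun _ _ => rfl
  have := j.isLt
  simp only [Finset.mem_filter, Finset.mem_range]
  omega

theorem mainTheorem3 {R : Type*} [CommRing R] {n : ℕ} [NeZero n] (lam : StrictPartition n)
    (x y : Fin n → R) (a : ℕ → R) :
    ∑ A ∈ asmSet lam, asmWeight x y a A =
      (∏ i, x i) * (∏ p : Fin n × Fin n with p.1 < p.2, (x p.1 + y p.2)) *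
        factorialSchur lam.subDelta x a := by
  -- Infinite sequences let the recursion on n keep the same variables; the values 0 beyond n never
  -- enter.
  obtain ⟨x', rfl⟩ : ∃ x' : ℕ → R, x = fun i : Fin n => x' i :=
    ⟨fun k => if h : k < n then x ⟨k, h⟩ else 0, by simp⟩
  obtain ⟨y', rfl⟩ : ∃ y' : ℕ → R, y = fun i : Fin n => y' i :=
    ⟨fun k => if h : k < n then y ⟨k, h⟩ else 0, by simp⟩
  rw [asmSet_eq_stateSet, Finset.sum_congr rfl fun A hA => asmWeight_eq x' y' a (mem_stateSet.mp hA),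
    ← Finset.mul_sum, sum_stateWeight x' y' a _ lam.strictAnti
      fun k => ⟨lam.pos k, lam.strictAnti.antitone (Fin.zero_le k)⟩,
    factorialSchur_eq_det x' a lam,
    prod_filter_lt_eq_prod_range n fun i j => x' i + y' j, mul_assoc]
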